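/- Let $p>2$ be a real number and put $\alpha=1/2-1/p$. Let $\mathcal H_\alpha[0,1]$ be the space of functions $x:[0,1]\to\mathbb R$ with $\sup_{s\ne t}|x(t)-x(s)|/|t-s|^\alpha<\infty$, with the norm $\|x\|_\alpha=w_\alpha(x,1)+|x(0)|$, where $w_\alpha(x,\delta)=\sup_{0<|t-s|<\delta}|x(t)-x(s)|/|t-s|^\alpha$. Then there exist a probability space $(\Omega,\mathcal F,\mu)$, a bijective bi-measurable map $T:\Omega\to\Omega$ preserving $\mu$, and a measurable function $f:\Omega\to\mathbb R$ with $\mathbb E|f|^p<\infty$ and $\mathbb E f=0$ such that the strictly stationary sequence $(f\circ T^j)_{j\ge 0}$ has the following properties, where $S_n(f)=\sum_{j=1}^n f\circ T^j$ and $$W_n(f,t)=n^{-1/2}\Big(S_{\lfloor nt\rfloor}(f)+(nt-\lfloor nt\rfloor)\,f\circ T^{\lfloor nt\rfloor+1}\Big),\qquad t\in[0,1]:$$ - the finite-dimensional distributions of $(W_n(f,\cdot))_{n\ge1}$ converge weakly to those of a standard Brownian motion on $[0,1]$; - the sequence $\big(\mathbb E|S_n(f)|^p/n^{p/2}\big)_{n\ge1}$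 is bounded; - the sequence of laws of $W_n(f,\cdot)$, $n\ge1$, is not tight in $\mathcal H_\alpha[0,1]$. -/

import Mathlib

open MeasureTheory ProbabilityTheory Filter Topology
open scoped NNReal ENNReal

namespace HolderWIP

noncomputable section

/-! ### The Hölder space on the unit interval -/

/-- The modulus `w_α(x, δ)`: the supremum of `|x t - x s| / |t - s| ^ α` over all `s, t ∈ [0, 1]`
with `0 < |t - s| < δ`, as an element of `[0, ∞]`. -/
def holderModulus (α : ℝ) (x : unitInterval → ℝ) (δ : ℝ) : ℝ≥0∞ :=
  ⨆ (s : unitInterval) (t : unitInterval)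
    (_ : 0 < |(t : ℝ) - (s : ℝ)| ∧ |(t : ℝ) - (s : ℝ)| < δ),
    ENNReal.ofReal (|x t - x s| / |(t : ℝ) - (s : ℝ)| ^ α)

/-- The linear space of the functions `x : [0, 1] → ℝ` for which the quotients
`|x t - x s| / |t - s| ^ α`, `s ≠ t`, are bounded. -/
def holderSubmodule (α : ℝ) : Submodule ℝ (unitInterval → ℝ) where
  carrier := {x | ∃ C : ℝ, ∀ s t : unitInterval, s ≠ t →
    |x t - x s| / |(t : ℝ) - (s : ℝ)| ^ α ≤ C}
  zero_mem' := ⟨0, fun s t _ => by simp⟩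
  add_mem' := by
    rintro x y ⟨C, hC⟩ ⟨D, hD⟩
    refine ⟨C + D, fun s t h => (le_trans ?_ (add_le_add (hC s t h) (hD s t h)))⟩
    rw [← add_div]
    gcongr
    simp only [Pi.add_apply]
    rw [show x t + y t - (x s + y s) = (x t - x s) + (y t - y s) by ring]
    exact abs_add_le _ _
  smul_mem' := by
    rintro c x ⟨C, hC⟩
    refine ⟨|c| * C, fun s t h => ?_⟩
    simp only [Pi.smul_apply, smul_eq_mul]
    rw [← mul_sub, abs_mul, mul_div_assoc]
    exact mul_le_mul_of_nonneg_left (hC s t h) (abs_nonneg c)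

/-- The Hölder space `H_α[0, 1]`. It is a type of its own so that its only topology is that of the
norm `‖x‖ = w_α(x, 1) + |x 0|` below. -/
def HolderSpace (α : ℝ) : Type := holderSubmodule α

namespace HolderSpace

variable {α : ℝ}

instance : AddCommGroup (HolderSpace α) := inferInstanceAs (AddCommGroup (holderSubmodule α))

instance : Module ℝ (HolderSpace α) := inferInstanceAs (Module ℝ (holderSubmodule α))

instance : CoeFun (HolderSpace α) (fun _ => unitInterval → ℝ) := ⟨fun x => x.1⟩

@[ext] theorem ext {x y : HolderSpace α} (h : ∀ t, x t = y t) : x = y := Subtype.ext (funext h)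

@[simp] theorem add_apply (x y : HolderSpace α) (t : unitInterval) : (x + y) t = x t + y t := rfl

@[simp] theorem neg_apply (x : HolderSpace α) (t : unitInterval) : (-x) t = -x t := rfl

@[simp] theorem zero_apply (t : unitInterval) : (0 : HolderSpace α) t = 0 := rfl

@[simp] theorem smul_apply (c : ℝ) (x : HolderSpace α) (t : unitInterval) :
    (c • x) t = c * x t := rfl

theorem modulus_lt_top (x : HolderSpace α) (δ : ℝ) : holderModulus α x δ < ∞ := by
  obtain ⟨C, hC⟩ := x.2
  refine lt_of_le_of_lt (b := ENNReal.ofReal C) ?_ ENNReal.ofReal_lt_top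
  refine iSup_le fun s => iSup_le fun t => iSup_le fun h => ENNReal.ofReal_le_ofReal (hC s t ?_)
  rintro rfl
  simp at h

theorem le_modulus (x : HolderSpace α) {δ : ℝ} {s t : unitInterval}
    (h0 : 0 < |(t : ℝ) - (s : ℝ)|) (h1 : |(t : ℝ) - (s : ℝ)| < δ) :
    |x t - x s| / |(t : ℝ) - (s : ℝ)| ^ α ≤ (holderModulus α x δ).toReal := by
  rw [← ENNReal.ofReal_le_iff_le_toReal (modulus_lt_top x δ).ne]
  exact le_iSup_of_le s (le_iSup_of_le t (le_iSup_of_le ⟨h0, h1⟩ le_rfl))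

theorem modulus_le (x : HolderSpace α) {δ C : ℝ} (hC : 0 ≤ C)
    (h : ∀ s t : unitInterval, 0 < |(t : ℝ) - (s : ℝ)| → |(t : ℝ) - (s : ℝ)| < δ →
      |x t - x s| / |(t : ℝ) - (s : ℝ)| ^ α ≤ C) :
    (holderModulus α x δ).toReal ≤ C := by
  refine ENNReal.toReal_le_of_le_ofReal hC ?_
  exact iSup_le fun s => iSup_le fun t => iSup_le fun hst =>
    ENNReal.ofReal_le_ofReal (h s t hst.1 hst.2)

instance : Norm (HolderSpace α) := ⟨fun x => (holderModulus α x 1).toReal + |x 0|⟩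

theorem norm_def (x : HolderSpace α) : ‖x‖ = (holderModulus α x 1).toReal + |x 0| := rfl

theorem normCore : NormedSpace.Core ℝ (HolderSpace α) where
  norm_nonneg x := add_nonneg ENNReal.toReal_nonneg (abs_nonneg _)
  norm_smul c x := by
    have key : ∀ (c : ℝ) (x : HolderSpace α),
        (holderModulus α (c • x : HolderSpace α) 1).toReal ≤ |c| * (holderModulus α x 1).toReal := by
      intro c x
      refine modulus_le _ (by positivity) fun s t h0 h1 => ?_
      simp only [smul_apply]
      rw [← mul_sub, abs_mul, mul_div_assoc]
      exact mul_le_mul_of_nonneg_left (le_modulus x h0 h1) (abs_nonneg c)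
    have hmod : (holderModulus α (c • x : HolderSpace α) 1).toReal = |c| * (holderModulus α x 1).toReal := by
      refine le_antisymm (key c x) ?_
      rcases eq_or_ne c 0 with rfl | hc
      · simp
      · have h := key c⁻¹ (c • x)
        rw [smul_smul, inv_mul_cancel₀ hc, one_smul, abs_inv] at h
        have hc' : 0 < |c| := abs_pos.2 hc
        calc |c| * (holderModulus α x 1).toReal
            ≤ |c| * (|c|⁻¹ * (holderModulus α (c • x : HolderSpace α) 1).toReal) := by gcongr
          _ = _ := by field_simp
    rw [norm_def, norm_def, hmod, smul_apply, abs_mul, Real.norm_eq_abs, mul_add]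
  norm_triangle x y := by
    have hmod : (holderModulus α (x + y : HolderSpace α) 1).toReal
        ≤ (holderModulus α x 1).toReal + (holderModulus α y 1).toReal := by
      refine modulus_le _ (by positivity) fun s t h0 h1 => ?_
      refine le_trans ?_ (add_le_add (le_modulus x h0 h1) (le_modulus y h0 h1))
      rw [← add_div]
      gcongr
      simp only [add_apply]
      rw [show x t + y t - (x s + y s) = (x t - x s) + (y t - y s) by ring]
      exact abs_add_le _ _
    have h0 := abs_add_le (x 0) (y 0)
    rw [norm_def, norm_def, norm_def, add_apply]
    linarith
  norm_eq_zero_iff x := by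
    constructor
    · intro h
      rw [norm_def] at h
      have hm : (holderModulus α x 1).toReal = 0 :=
        le_antisymm (by linarith [abs_nonneg (x 0)]) ENNReal.toReal_nonneg
      have h0 : x 0 = 0 := abs_eq_zero.1 (by linarith)
      have hd : ∀ s t : unitInterval, |(t : ℝ) - (s : ℝ)| < 1 → x t = x s := by
        intro s t h1
        rcases eq_or_ne s t with rfl | hst
        · rfl
        · have hp : 0 < |(t : ℝ) - (s : ℝ)| :=
            abs_pos.2 (sub_ne_zero.2 fun he => hst (Subtype.ext he.symm))
          have hle := le_modulus x hp h1
          rw [hm, div_le_iff₀ (by positivity), zero_mul] at hle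
          exact sub_eq_zero.1 (abs_eq_zero.1 (le_antisymm hle (abs_nonneg _)))
      let m : unitInterval := ⟨1 / 2, by norm_num, by norm_num⟩
      have hm0 : x m = x 0 := hd 0 m (by norm_num [m])
      ext t
      have ht : x t = x m := by
        refine hd m t ?_
        have h1 := t.2.1
        have h2 := t.2.2
        simp only [m]
        rw [abs_lt]
        constructor <;> linarith
      rw [ht, hm0, h0, zero_apply]
    · rintro rfl
      rw [norm_def]
      have : (holderModulus α (0 : HolderSpace α) 1).toReal ≤ 0 :=
        modulus_le _ le_rfl fun s t _ _ => by simp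
      rw [le_antisymm this ENNReal.toReal_nonneg]
      simp

instance : NormedAddCommGroup (HolderSpace α) := NormedAddCommGroup.ofCore normCore

instance : NormedSpace ℝ (HolderSpace α) := NormedSpace.ofCore normCore

instance : MeasurableSpace (HolderSpace α) := borel _

instance : BorelSpace (HolderSpace α) := ⟨rfl⟩

end HolderSpace

/-! ### Partial sums and the normalized partial sum process -/

variable {Ω : Type*}

/-- `S_n(f) = ∑_{j=1}^n f ∘ T^j`. -/
def partialSum (T : Ω → Ω) (f : Ω → ℝ) (n : ℕ) (ω : Ω) : ℝ :=
  ∑ j ∈ Finset.Icc 1 n, f (T^[j] ω)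

/-- The normalized polygonal partial sum process
`W_n(f, t) = n^{-1/2} (S_{⌊nt⌋}(f) + (nt - ⌊nt⌋) f ∘ T^{⌊nt⌋ + 1})`, for `t ≥ 0`. -/
def partialSumProcess (T : Ω → Ω) (f : Ω → ℝ) (n : ℕ) (t : ℝ) (ω : Ω) : ℝ :=
  (√(n : ℝ))⁻¹ * (partialSum T f ⌊(n : ℝ) * t⌋₊ ω +
    ((n : ℝ) * t - (⌊(n : ℝ) * t⌋₊ : ℝ)) * f (T^[⌊(n : ℝ) * t⌋₊ + 1] ω))

/-- The function `u ↦ max(0, min(1, u - j))`. -/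
def ramp (j : ℕ) (u : ℝ) : ℝ := max 0 (min 1 (u - j))

theorem sum_ramp (X : ℕ → ℝ) (n : ℕ) {u : ℝ} (h0 : 0 ≤ u) (hn : u ≤ n) :
    ∑ j ∈ Finset.range (n + 1), X (j + 1) * ramp j u =
      ∑ j ∈ Finset.Icc 1 ⌊u⌋₊, X j + (u - ⌊u⌋₊) * X (⌊u⌋₊ + 1) := by
  have hk : ⌊u⌋₊ ≤ n := Nat.floor_le_of_le hn
  have h1 : (⌊u⌋₊ : ℝ) ≤ u := Nat.floor_le h0
  have h2 : u < ⌊u⌋₊ + 1 := Nat.lt_floor_add_one u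
  generalize ⌊u⌋₊ = k at *
  have hlow : ∀ j ∈ Finset.range k, X (j + 1) * ramp j u = X (j + 1) := by
    intro j hj
    have hj' : (j : ℝ) + 1 ≤ k := by exact_mod_cast Finset.mem_range.1 hj
    rw [ramp, min_eq_left (by linarith), max_eq_right zero_le_one, mul_one]
  have hhigh : ∀ j ∈ Finset.range (n + 1), j ∉ Finset.range (k + 1) →
      X (j + 1) * ramp j u = 0 := by
    intro j _ hj
    have hj' : (k : ℝ) + 1 ≤ j := by
      exact_mod_cast not_lt.1 (fun h => hj (Finset.mem_range.2 h))
    rw [ramp, max_eq_left ((min_le_right _ _).trans (by linarith)), mul_zero]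
  rw [← Finset.sum_subset (Finset.range_mono (Nat.succ_le_succ hk)) hhigh,
    Finset.sum_range_succ, Finset.sum_congr rfl hlow, ramp, min_eq_right (by linarith),
    max_eq_right (by linarith), mul_comm (X (k + 1))]
  congr 1
  rw [Finset.range_eq_Ico, Finset.sum_Ico_add' X 0 k 1, zero_add]
  rfl

theorem abs_ramp_sub_le (j : ℕ) (u v : ℝ) : |ramp j u - ramp j v| ≤ |u - v| := by
  unfold ramp
  refine (abs_max_sub_max_le_max _ _ _ _).trans ?_
  rw [sub_self, abs_zero, max_eq_right (abs_nonneg _)]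
  refine (abs_min_sub_min_le_max _ _ _ _).trans ?_
  rw [sub_self, abs_zero, max_eq_right (abs_nonneg _)]
  exact le_of_eq (by congr 1; ring)

theorem ramp_mem {α : ℝ} (hα : α ≤ 1) (n j : ℕ) :
    (fun t : unitInterval => ramp j ((n : ℝ) * t)) ∈ holderSubmodule α := by
  refine ⟨n, fun s t hst => ?_⟩
  have hp : 0 < |(t : ℝ) - (s : ℝ)| :=
    abs_pos.2 (sub_ne_zero.2 fun he => hst (Subtype.ext he.symm))
  have hle : |(t : ℝ) - (s : ℝ)| ≤ 1 := by
    rw [abs_le]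
    constructor <;> linarith [t.2.1, t.2.2, s.2.1, s.2.2]
  rw [div_le_iff₀ (by positivity)]
  calc |ramp j ((n : ℝ) * t) - ramp j ((n : ℝ) * s)| ≤ |(n : ℝ) * t - (n : ℝ) * s| :=
        abs_ramp_sub_le _ _ _
    _ = n * |(t : ℝ) - (s : ℝ)| ^ (1 : ℝ) := by
        rw [← mul_sub, abs_mul, Nat.abs_cast, Real.rpow_one]
    _ ≤ n * |(t : ℝ) - (s : ℝ)| ^ α := by
        gcongr n * ?_
        exact Real.rpow_le_rpow_of_exponent_ge hp hle hα

theorem partialSumProcess_eq_sum_ramp (T : Ω → Ω) (f : Ω → ℝ) (n : ℕ) (ω : Ω)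
    (t : unitInterval) :
    partialSumProcess T f n t ω = ∑ j ∈ Finset.range (n + 1),
      ((√(n : ℝ))⁻¹ * f (T^[j + 1] ω)) * ramp j ((n : ℝ) * t) := by
  have h0 : 0 ≤ (n : ℝ) * t := mul_nonneg n.cast_nonneg t.2.1
  have h1 : (n : ℝ) * t ≤ n := mul_le_of_le_one_right n.cast_nonneg t.2.2
  rw [partialSumProcess, partialSum, ← sum_ramp (fun j => f (T^[j] ω)) n h0 h1, Finset.mul_sum]
  exact Finset.sum_congr rfl fun j _ => by ring

theorem partialSumProcess_mem {α : ℝ} (hα : α ≤ 1) (T : Ω → Ω) (f : Ω → ℝ) (n : ℕ) (ω : Ω) :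
    (fun t : unitInterval => partialSumProcess T f n t ω) ∈ holderSubmodule α := by
  have h : (fun t : unitInterval => partialSumProcess T f n t ω) =
      ∑ j ∈ Finset.range (n + 1), ((√(n : ℝ))⁻¹ * f (T^[j + 1] ω)) •
        fun t : unitInterval => ramp j ((n : ℝ) * t) := by
    ext t
    rw [partialSumProcess_eq_sum_ramp]
    simp
  rw [h]
  exact Submodule.sum_mem _ fun j _ => Submodule.smul_mem _ _ (ramp_mem hα n j)

/-- `W_n(f)` as a random element of `H_α[0, 1]`: the path `t ↦ W_n(f, t)` on `[0, 1]`, which is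
Lipschitz, hence in `H_α[0, 1]` as soon as `α ≤ 1`. -/
def holderPartialSumProcess {α : ℝ} (hα : α ≤ 1) (T : Ω → Ω) (f : Ω → ℝ) (n : ℕ) (ω : Ω) :
    HolderSpace α :=
  ⟨fun t : unitInterval => partialSumProcess T f n t ω, partialSumProcess_mem hα T f n ω⟩

/-- `W_n(f)` is Borel measurable as a map into `H_α[0, 1]`, so that its law is meaningful. -/
theorem measurable_holderPartialSumProcess [MeasurableSpace Ω] {α : ℝ} (hα : α ≤ 1)
    {T : Ω → Ω} (hT : Measurable T) {f : Ω → ℝ} (hf : Measurable f) (n : ℕ) :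
    Measurable (holderPartialSumProcess hα T f n) := by
  let e : ℕ → HolderSpace α := fun j =>
    ⟨fun t : unitInterval => ramp j ((n : ℝ) * t), ramp_mem hα n j⟩
  let L : (Fin (n + 1) → ℝ) → HolderSpace α := fun y => ∑ j, y j • e j
  have hL : Continuous L := by fun_prop
  let Y : Ω → Fin (n + 1) → ℝ := fun ω j => (√(n : ℝ))⁻¹ * f (T^[(j : ℕ) + 1] ω)
  have hY : Measurable Y := by
    refine measurable_pi_lambda _ fun j => ?_
    exact (hf.comp (hT.iterate _)).const_mul _
  have h : holderPartialSumProcess hα T f n = L ∘ Y := by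
    ext ω t
    change partialSumProcess T f n t ω = (L (Y ω)).1 t
    rw [partialSumProcess_eq_sum_ramp]
    have hsum : (L (Y ω)).1 = ∑ j : Fin (n + 1), (Y ω j) • (e j).1 := by
      change (holderSubmodule α).subtype (∑ j : Fin (n + 1), (Y ω j) • (e j)) = _
      exact map_sum (holderSubmodule α).subtype _ _
    rw [hsum, Finset.sum_apply, Finset.sum_range]
    rfl
  rw [h]
  exact hL.measurable.comp hY

theorem half_sub_inv_le_one {p : ℝ} (hp : 2 < p) : 1 / 2 - 1 / p ≤ 1 := by
  have : 0 < 1 / p := by positivity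
  linarith

/-- The finite-dimensional distributions of `(W_n(f))` on `[0, 1]` converge weakly to those of
standard Brownian motion: `BrownianReal.projectiveFamily I` is the centered Gaussian law on `ℝ^I`
with covariance `min s t`. -/
def FiniteDimTendstoBrownian [MeasurableSpace Ω] (μ : Measure Ω) [IsProbabilityMeasure μ]
    (T : Ω → Ω) (f : Ω → ℝ) : Prop :=
  ∀ I : Finset ℝ≥0, (∀ t ∈ I, t ≤ 1) →
    TendstoInDistribution (fun (n : ℕ) (ω : Ω) (t : I) => partialSumProcess T f n (t : ℝ≥0) ω)
      atTop (id : (I → ℝ) → I → ℝ) (fun _ => μ) (BrownianReal.projectiveFamily I)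

end

end HolderWIP

/-!
The stationary sequence is a sum `f = m + h` of two independent parts, realized on the product of
two dynamical systems.

The part `m` is white noise: independent standard Gaussian variables under the shift. Its partial
sum processes are Gaussian, so Lévy's theorem reduces the convergence of their finite-dimensional
distributions to that of their covariances, and `E |S_n(m)| ^ p` is a constant times `n ^ (p / 2)`.

The part `h` lives on the product over `k` of the cyclic groups of order `N = L * M`, where
`L = 4096 ^ k` and `M = 2 ^ (k + 1)`, with the uniform measures and the translation by `1` in every
coordinate. On the `k`-th group sits a tent of half-width `L` and height `H = √L * M ^ (1 / p)`,
and `h` is the sum over `k` of the one-step increments of these tents along the orbit. Since the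
slopes `H / L` decay geometrically, `h` is bounded. As `h` is a sum of coboundaries, its partial
sums telescope (`partialSum_oscillation`), and three things happen.

* The level `k` contributes to `S_n(h)` with probability at most `4 / M`, and then by at most
  `min (n * H / L) H`. Hence its `p`-norm is at most `4 √n min (√(n / L)) (√(L / n))`
  (`eLpNorm_tentIncrement_le`), and the sum over `k` is `O(√n)`, because `∑ min (u, 1 / u)` along a
  geometric progression is bounded (`sum_min_geometric_le`).
* Up to an event of small probability only finitely many levels contribute, so `S_n(h)` is bounded
  in probability (`phaseMeasure_partialSum_oscillation_le`). Thus `h` does not affect the limit of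
  the finite-dimensional distributions.
* Within `N` steps every orbit meets the top of the tent of level `k`, whence it descends by `H` in
  `L` steps; the lower tents are too low and the higher ones too flat to compensate
  (`exists_large_increment_oscillation`), and the Gaussian increments over `L` steps, being of
  order `√L`, are negligible. For `n = 2 * N` the path `W_n(f)` thus has, with probability at least
  `1 / 2`, an increment of order `(L / n) ^ α` over an interval of length `L / n = 1 / (2 * M)`. As
  these lengths tend to `0`, no compact set of the Hölder space contains such polygonal paths for
  all `k` (`HolderSpace.false_of_large_increments`).
-/

namespace HolderWIP

noncomputable section

/-! ### Independent standard Gaussian sequences -/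

section Gaussian

variable {Ω : Type*} [MeasurableSpace Ω] {P : Measure Ω} {X : ℕ → Ω → ℝ}

/-- Finitely many weighted sums of independent standard Gaussian variables are jointly Gaussian. -/
theorem hasGaussianLaw_weightedSums {κ : Type*} [Finite κ]
    (hX : ∀ j, HasLaw (X j) (gaussianReal 0 1) P) (hind : iIndepFun X P)
    (s : Finset ℕ) (c : κ → ℕ → ℝ) :
    HasGaussianLaw (fun ω (i : κ) => ∑ j ∈ s, c i j * X j ω) P := by
  have := Fintype.ofFinite κ
  have h1 : HasGaussianLaw (fun ω (j : s) => X j ω) P :=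
    iIndepFun.hasGaussianLaw (fun j => (hX j).hasGaussianLaw)
      (hind.precomp Subtype.val_injective)
  let L : (s → ℝ) →L[ℝ] (κ → ℝ) :=
    ContinuousLinearMap.pi fun i => ∑ j : s, c i j • ContinuousLinearMap.proj j
  have h2 := h1.map L
  have h3 : (L ∘ fun ω (j : s) => X j ω) = fun ω (i : κ) => ∑ j ∈ s, c i j * X j ω := by
    ext ω i
    simp only [L, Function.comp_apply, ContinuousLinearMap.coe_pi', _root_.sum_apply,
      _root_.smul_apply, ContinuousLinearMap.proj_apply, smul_eq_mul]
    exact s.sum_coe_sort (fun j => c i j * X j ω)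
  rwa [h3] at h2

theorem covariance_weightedSums (hX : ∀ j, HasLaw (X j) (gaussianReal 0 1) P)
    (hind : iIndepFun X P) (s : Finset ℕ) (c d : ℕ → ℝ) :
    cov[fun ω => ∑ j ∈ s, c j * X j ω, fun ω => ∑ j ∈ s, d j * X j ω; P] =
      ∑ j ∈ s, c j * d j := by
  have := hind.isProbabilityMeasure
  have hL : ∀ j, MemLp (X j) 2 P := fun j => (hX j).hasGaussianLaw.memLp_two
  have e : ∀ (c : ℕ → ℝ), (fun ω => ∑ j ∈ s, c j * X j ω) =
      fun ω => ∑ j : s, c j * X j ω := fun c => by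
    ext ω; exact (s.sum_coe_sort (fun j => c j * X j ω)).symm
  rw [e, e, covariance_fun_sum_fun_sum (X := fun (j : s) ω => c j * X j ω)
    (Y := fun (j : s) ω => d j * X j ω) (fun i => (hL i).const_mul _)
    (fun i => (hL i).const_mul _), ← s.sum_coe_sort]
  refine Finset.sum_congr rfl fun i _ => ?_
  rw [Finset.sum_eq_single i]
  · rw [covariance_const_mul_left, covariance_const_mul_right, covariance_self (hX i).aemeasurable,
      (hX i).variance_eq, variance_id_gaussianReal]
    simp
  · intro j _ hj
    rw [covariance_const_mul_left, covariance_const_mul_right,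
      (hind.indepFun (fun h => hj (Subtype.ext h.symm))).covariance_eq_zero (hL i) (hL j)]
    simp
  · simp

theorem integral_weightedSum (hX : ∀ j, HasLaw (X j) (gaussianReal 0 1) P) (s : Finset ℕ)
    (c : ℕ → ℝ) : ∫ ω, ∑ j ∈ s, c j * X j ω ∂P = 0 := by
  rw [integral_finsetSum _ fun j _ => ((hX j).hasGaussianLaw.integrable).const_mul _]
  refine Finset.sum_eq_zero fun j _ => ?_
  rw [integral_const_mul, (hX j).integral_eq, integral_id_gaussianReal, mul_zero]

/-- A sum of independent standard Gaussian variables is centered Gaussian, its variance being the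
number of summands. -/
theorem hasLaw_sum_gaussian (hX : ∀ j, HasLaw (X j) (gaussianReal 0 1) P)
    (hind : iIndepFun X P) (s : Finset ℕ) :
    HasLaw (fun ω => ∑ j ∈ s, X j ω) (gaussianReal 0 s.card) P := by
  have h1 : HasGaussianLaw (fun ω => ∑ j ∈ s, X j ω) P := by
    have := (hasGaussianLaw_weightedSums hX hind s (fun (_ : Unit) _ => 1)).eval ()
    simpa using this
  have h2 := covariance_weightedSums hX hind s (fun _ => 1) (fun _ => 1)
  have h3 := integral_weightedSum hX s (fun _ => 1)
  simp only [one_mul] at h2 h3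
  rw [covariance_self h1.aemeasurable] at h2
  refine ⟨h1.aemeasurable, ?_⟩
  rw [h1.map_eq_gaussianReal, h2, h3]
  congr 1
  ext
  simp

end Gaussian

theorem ramp_nonneg (j : ℕ) (u : ℝ) : 0 ≤ ramp j u := le_max_left _ _

theorem ramp_le_one (j : ℕ) (u : ℝ) : ramp j u ≤ 1 := max_le zero_le_one (min_le_left _ _)

theorem ramp_eq_one {j : ℕ} {u : ℝ} (h : (j : ℝ) + 1 ≤ u) : ramp j u = 1 := by
  rw [ramp, min_eq_left (by linarith), max_eq_right zero_le_one]

/-- Only the summand `j = ⌊u⌋₊` involves a proper fraction: for `j < ⌊u⌋₊` both ramps are `1`, and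
for `j > ⌊u⌋₊` the first one vanishes. -/
theorem abs_sum_ramp_mul_ramp_sub_le (n : ℕ) {u v : ℝ} (h0 : 0 ≤ u) (huv : u ≤ v) (hn : u ≤ n) :
    |∑ j ∈ Finset.range (n + 1), ramp j u * ramp j v - u| ≤ 1 := by
  have h := sum_ramp (fun j => ramp (j - 1) v) n h0 hn
  -- By `sum_ramp` the sum lies between `⌊u⌋₊` and `u`.
  simp only [Nat.add_sub_cancel] at h
  have h1 : (⌊u⌋₊ : ℝ) ≤ u := Nat.floor_le h0
  have h2 : u < ⌊u⌋₊ + 1 := Nat.lt_floor_add_one u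
  have h3 : ∑ j ∈ Finset.Icc 1 ⌊u⌋₊, ramp (j - 1) v = ⌊u⌋₊ := by
    rw [Finset.sum_congr rfl (g := fun _ => (1 : ℝ))]
    · simp
    · intro j hj
      rw [Finset.mem_Icc] at hj
      refine ramp_eq_one ?_
      have : ((j - 1 : ℕ) : ℝ) + 1 = j := by exact_mod_cast Nat.sub_add_cancel hj.1
      rw [this]
      have : (j : ℝ) ≤ ⌊u⌋₊ := by exact_mod_cast hj.2
      linarith
  simp_rw [mul_comm (ramp _ u)]
  rw [h, h3]
  have h4 := ramp_nonneg ⌊u⌋₊ v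
  have h5 := ramp_le_one ⌊u⌋₊ v
  rw [abs_le]
  constructor <;> nlinarith

/-- The covariances of the normalized polygonal process converge to those of Brownian motion. -/
theorem tendsto_sum_ramp_mul_ramp {s t : ℝ} (hs : 0 ≤ s) (ht : 0 ≤ t) (hs1 : s ≤ 1) (ht1 : t ≤ 1) :
    Tendsto (fun n : ℕ => (n : ℝ)⁻¹ * ∑ j ∈ Finset.range (n + 1),
      ramp j (n * s) * ramp j (n * t)) atTop (𝓝 (min s t)) := by
  wlog hst : s ≤ t generalizing s t
  · rw [min_comm]
    simp_rw [mul_comm (ramp _ (_ * s))]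
    exact this ht hs ht1 hs1 (le_of_not_ge hst)
  rw [min_eq_left hst, tendsto_iff_dist_tendsto_zero]
  refine squeeze_zero' (Eventually.of_forall fun _ => dist_nonneg) ?_
    (tendsto_inv_atTop_nhds_zero_nat (𝕜 := ℝ))
  filter_upwards [eventually_gt_atTop 0] with n hn
  have hn' : (0 : ℝ) < n := by exact_mod_cast hn
  have := abs_sum_ramp_mul_ramp_sub_le n (u := n * s) (v := n * t) (by positivity) (by gcongr)
    (mul_le_of_le_one_right hn'.le hs1)
  rw [Real.dist_eq]
  calc |(n : ℝ)⁻¹ * ∑ j ∈ Finset.range (n + 1), ramp j (n * s) * ramp j (n * t) - s|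
      = |(n : ℝ)⁻¹ * (∑ j ∈ Finset.range (n + 1), ramp j (n * s) * ramp j (n * t) - n * s)| := by
        congr 1; field_simp
    _ = (n : ℝ)⁻¹ * |∑ j ∈ Finset.range (n + 1), ramp j (n * s) * ramp j (n * t) - n * s| := by
        rw [abs_mul, abs_of_pos (inv_pos.2 hn')]
    _ ≤ (n : ℝ)⁻¹ * 1 := by gcongr
    _ = _ := mul_one _

/-- **Donsker's theorem for the finite-dimensional distributions, Gaussian case.** The vectors
`(W_n(t))_{t ∈ I}` are centered Gaussian, so by Lévy's theorem it is enough that their covariances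
converge. -/
theorem finiteDimTendstoBrownian_of_gaussian {Ω : Type*} [MeasurableSpace Ω] (μ : Measure Ω)
    [IsProbabilityMeasure μ] (T : Ω → Ω) (f : Ω → ℝ)
    (hX : ∀ j : ℕ, HasLaw (fun ω => f (T^[j] ω)) (gaussianReal 0 1) μ)
    (hind : iIndepFun (fun (j : ℕ) ω => f (T^[j] ω)) μ) :
    FiniteDimTendstoBrownian μ T f := by
  intro I hI
  let c : ℕ → I → ℕ → ℝ := fun n t j => (√(n : ℝ))⁻¹ * ramp (j - 1) (n * (t : ℝ≥0))
  let s : ℕ → Finset ℕ := fun n => Finset.Icc 1 (n + 1)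
  have hform : ∀ (n : ℕ) (ω : Ω) (t : I), partialSumProcess T f n (t : ℝ≥0) ω =
      ∑ j ∈ s n, c n t j * f (T^[j] ω) := by
    intro n ω t
    have ht : ((t : ℝ≥0) : ℝ) ≤ 1 := by exact_mod_cast hI t t.2
    have := partialSumProcess_eq_sum_ramp T f n ω ⟨(t : ℝ≥0), (t : ℝ≥0).2, ht⟩
    simp only at this
    rw [this, show s n = Finset.Ico (0 + 1) (n + 1 + 1) from rfl,
      ← Finset.sum_Ico_add' (fun j => c n t j * f (T^[j] ω)), ← Finset.range_eq_Ico]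
    refine Finset.sum_congr rfl fun j _ => ?_
    simp only [c, Nat.add_sub_cancel]
    ring
  have hG : ∀ n, HasGaussianLaw (fun ω (t : I) => partialSumProcess T f n (t : ℝ≥0) ω) μ := by
    intro n
    simp_rw [hform]
    exact hasGaussianLaw_weightedSums hX hind (s n) (c n)
  have hG2 : ∀ n, HasGaussianLaw
      (fun ω => WithLp.toLp 2 fun (t : I) => partialSumProcess T f n (t : ℝ≥0) ω) μ := fun n =>
    (hG n).map (PiLp.continuousLinearEquiv 2 ℝ (fun _ : I => ℝ)).symm.toContinuousLinearMap
  have hcov : ∀ (n : ℕ) (t t' : I), cov[fun ω => partialSumProcess T f n (t : ℝ≥0) ω,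
      fun ω => partialSumProcess T f n (t' : ℝ≥0) ω; μ] =
      (n : ℝ)⁻¹ * ∑ j ∈ Finset.range (n + 1),
        ramp j (n * (t : ℝ≥0)) * ramp j (n * (t' : ℝ≥0)) := by
    intro n t t'
    simp_rw [hform]
    rw [covariance_weightedSums hX hind, show s n = Finset.Ico (0 + 1) (n + 1 + 1) from rfl,
      ← Finset.sum_Ico_add' (fun j => c n t j * c n t' j), ← Finset.range_eq_Ico, Finset.mul_sum]
    refine Finset.sum_congr rfl fun j _ => ?_
    have : (√(n : ℝ))⁻¹ * (√(n : ℝ))⁻¹ = (n : ℝ)⁻¹ := by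
      rw [← mul_inv, Real.mul_self_sqrt n.cast_nonneg]
    simp only [c, Nat.add_sub_cancel]
    rw [← this]
    ring
  have hmean : ∀ (n : ℕ) (t : I), ∫ ω, partialSumProcess T f n (t : ℝ≥0) ω ∂μ = 0 := by
    intro n t
    simp_rw [hform]
    exact integral_weightedSum hX (s n) (c n t)
  have key : TendstoInDistribution
      (fun (n : ℕ) (ω : Ω) => WithLp.toLp 2 fun (t : I) => partialSumProcess T f n (t : ℝ≥0) ω)
      atTop (WithLp.toLp 2 : (I → ℝ) → EuclideanSpace ℝ I) (fun _ => μ)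
      (BrownianReal.projectiveFamily I) := by
    refine ⟨fun n => (hG2 n).aemeasurable, by fun_prop, ?_⟩
    refine ProbabilityMeasure.tendsto_iff_tendsto_charFun.2 fun x => ?_
    have hlim : charFun ((BrownianReal.projectiveFamily I).map
        (WithLp.toLp 2 : (I → ℝ) → EuclideanSpace ℝ I)) x =
        Complex.exp (-((∑ i : I, ∑ j : I, x i * x j *
          (min (i : ℝ≥0) (j : ℝ≥0) : ℝ≥0) : ℝ) : ℂ) / 2) := by
      have hg : IsGaussian ((BrownianReal.projectiveFamily I).map
          (WithLp.toLp 2 : (I → ℝ) → EuclideanSpace ℝ I)) := by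
        rw [(BrownianReal.measurePreserving_toLp_projectiveFamily I).map_eq]
        infer_instance
      have hm : ∫ y, id y ∂((BrownianReal.projectiveFamily I).map
          (WithLp.toLp 2 : (I → ℝ) → EuclideanSpace ℝ I)) = 0 := by
        rw [(BrownianReal.measurePreserving_toLp_projectiveFamily I).map_eq]
        exact integral_id_multivariateGaussian
      rw [IsGaussian.charFun_eq', hm]
      have hc := covarianceBilin_apply_pi (μ := BrownianReal.projectiveFamily I)
        (X := fun (i : I) y => y i)
        (fun i => (IsGaussian.hasGaussianLaw_id.eval i).memLp_two) x x
      rw [hc]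
      simp_rw [BrownianReal.covariance_eval_projectiveFamily]
      simp [neg_div]
    have hn : ∀ n : ℕ, charFun (μ.map fun ω => WithLp.toLp 2 fun (t : I) =>
        partialSumProcess T f n (t : ℝ≥0) ω) x =
        Complex.exp (-((∑ i : I, ∑ j : I, x i * x j * ((n : ℝ)⁻¹ * ∑ l ∈ Finset.range (n + 1),
        ramp l (n * (i : ℝ≥0)) * ramp l (n * (j : ℝ≥0))) : ℝ) : ℂ) / 2) := by
      intro n
      have hg := (hG2 n).isGaussian_map
      have hm : ∫ y, id y ∂(μ.map fun ω => WithLp.toLp 2 fun (t : I) =>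
          partialSumProcess T f n (t : ℝ≥0) ω) = 0 := by
        rw [integral_map (hG2 n).aemeasurable (by fun_prop)]
        simp only [id]
        ext i
        rw [eval_integral_piLp]
        · simpa using hmean n i
        · intro i
          exact ((hG n).eval i).integrable
      rw [IsGaussian.charFun_eq', hm]
      have hc := covarianceBilin_apply_pi (μ := μ)
        (X := fun (i : I) ω => partialSumProcess T f n (i : ℝ≥0) ω)
        (fun i => ((hG n).eval i).memLp_two) x x
      rw [hc]
      simp_rw [hcov]
      simp [neg_div]
    simp only [ProbabilityMeasure.coe_mk]
    rw [hlim]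
    simp_rw [hn]
    refine (Complex.continuous_exp.tendsto _).comp ?_
    refine Tendsto.div_const (Tendsto.neg ?_) _
    refine (Complex.continuous_ofReal.tendsto _).comp ?_
    refine tendsto_finsetSum _ fun i _ => tendsto_finsetSum _ fun j _ => Tendsto.const_mul _ ?_
    have := tendsto_sum_ramp_mul_ramp (i : ℝ≥0).2 (j : ℝ≥0).2
      (by exact_mod_cast hI i i.2) (by exact_mod_cast hI j j.2)
    rw [NNReal.coe_min]
    exact this
  have := key.continuous_comp (g := WithLp.ofLp) (by fun_prop)
  exact this

/-! ### Tents on cyclic groups -/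

/-- Half the width of the tent of level `k`. -/
def tentLength (k : ℕ) : ℕ := 4096 ^ k

/-- The period of the tent of level `k`: consecutive tents are `2 ^ (k + 1)` half-widths apart. -/
def tentPeriod (k : ℕ) : ℕ := 2 ^ (k + 1) * tentLength k

/-- The height of the tent of level `k`, namely `√L * M ^ (1 / p)` with `L = tentLength k` and
`M = 2 ^ (k + 1)`: this is the size which the `α`-Hölder norm sees over `L` steps. -/
def tentHeight (p : ℝ) (k : ℕ) : ℝ := 64 ^ k * ((2 : ℝ) ^ (1 / p)) ^ (k + 1)

/-- The slope of the tent of level `k`. -/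
def tentSlope (p : ℝ) (k : ℕ) : ℝ := tentHeight p k / tentLength k

/-- The tent of level `k` on the cyclic group `ZMod (tentPeriod k)`: it peaks at `0`, and vanishes
at distance at least `tentLength k` from `0`. -/
def tent (p : ℝ) (k : ℕ) (x : ZMod (tentPeriod k)) : ℝ :=
  tentSlope p k * ((tentLength k - x.valMinAbs.natAbs : ℕ) : ℝ)

theorem tentLength_pos (k : ℕ) : 0 < tentLength k := by unfold tentLength; positivity

theorem two_mul_tentLength_le (k : ℕ) : 2 * tentLength k ≤ tentPeriod k := by
  unfold tentPeriod
  gcongr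
  exact Nat.le_self_pow (by omega) 2

instance (k : ℕ) : NeZero (tentPeriod k) :=
  ⟨by have := tentLength_pos k; unfold tentPeriod; positivity⟩

variable {p : ℝ}

theorem tentHeight_pos (k : ℕ) : 0 < tentHeight p k := by unfold tentHeight; positivity

theorem tentSlope_pos (k : ℕ) : 0 < tentSlope p k :=
  div_pos (tentHeight_pos k) (by exact_mod_cast tentLength_pos k)

theorem tentSlope_mul_tentLength (k : ℕ) : tentSlope p k * tentLength k = tentHeight p k :=
  div_mul_cancel₀ _ (by exact_mod_cast (tentLength_pos k).ne')

theorem tentSlope_eq (k : ℕ) : tentSlope p k = ((2 : ℝ) ^ (1 / p)) ^ (k + 1) / 64 ^ k := by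
  have : (tentLength k : ℝ) = 64 ^ k * 64 ^ k := by
    rw [tentLength, ← mul_pow]; norm_num
  rw [tentSlope, tentHeight, this]
  field_simp

theorem two_rpow_inv_le_two (hp : 1 ≤ p) : (2 : ℝ) ^ (1 / p) ≤ 2 := by
  have : 1 / p ≤ 1 := by rw [div_le_one (by linarith)]; exact hp
  calc (2 : ℝ) ^ (1 / p) ≤ 2 ^ (1 : ℝ) := Real.rpow_le_rpow_of_exponent_le one_le_two this
    _ = 2 := Real.rpow_one _

theorem one_le_two_rpow_inv (hp : 0 ≤ p) : 1 ≤ (2 : ℝ) ^ (1 / p) :=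
  Real.one_le_rpow one_le_two (by positivity)

theorem tentSlope_succ_le (hp : 1 ≤ p) (k : ℕ) : tentSlope p (k + 1) ≤ tentSlope p k / 32 := by
  rw [tentSlope_eq, tentSlope_eq, pow_succ _ (k + 1), pow_succ (64 : ℝ)]
  have := two_rpow_inv_le_two hp
  rw [div_div, div_le_div_iff₀ (by positivity) (by positivity)]
  have h : 0 ≤ ((2 : ℝ) ^ (1 / p)) ^ (k + 1) * 64 ^ k := by positivity
  nlinarith

theorem tentHeight_succ_ge (hp : 0 ≤ p) (k : ℕ) : 64 * tentHeight p k ≤ tentHeight p (k + 1) := by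
  rw [tentHeight, tentHeight, pow_succ _ (k + 1), pow_succ (64 : ℝ)]
  have := one_le_two_rpow_inv hp
  have h : 0 ≤ 64 ^ k * ((2 : ℝ) ^ (1 / p)) ^ (k + 1) := by positivity
  nlinarith

theorem tentSlope_add_le (hp : 1 ≤ p) (k i : ℕ) :
    tentSlope p (k + i) ≤ tentSlope p k * (1 / 32) ^ i := by
  induction i with
  | zero => simp
  | succ i ih =>
    rw [← add_assoc, pow_succ]
    have := tentSlope_succ_le hp (k + i)
    linarith

theorem summable_tentSlope (hp : 1 ≤ p) : Summable (tentSlope p) := by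
  refine Summable.of_nonneg_of_le (fun k => (tentSlope_pos k).le) (fun k => ?_)
    ((summable_geometric_of_lt_one (r := (1 / 32 : ℝ)) (by norm_num) (by norm_num)).mul_left
      (tentSlope p 0))
  simpa using tentSlope_add_le hp 0 k

theorem tsum_tentSlope_tail_le (hp : 1 ≤ p) (k : ℕ) :
    ∑' i, tentSlope p (i + (k + 1)) ≤ tentSlope p k / 31 := by
  have hs : Summable fun i : ℕ => tentSlope p (k + 1) * (1 / 32 : ℝ) ^ i :=
    (summable_geometric_of_lt_one (by norm_num) (by norm_num)).mul_left _
  have h1 : ∑' i, tentSlope p (i + (k + 1)) ≤ ∑' i : ℕ, tentSlope p (k + 1) * (1 / 32 : ℝ) ^ i := by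
    refine Summable.tsum_le_tsum (fun i => ?_) ((summable_nat_add_iff (k + 1)).2
      (summable_tentSlope hp)) hs
    rw [add_comm]
    exact tentSlope_add_le hp _ _
  rw [tsum_mul_left, tsum_geometric_of_lt_one (by norm_num) (by norm_num)] at h1
  have := tentSlope_succ_le hp k
  norm_num at h1
  linarith

theorem sum_tentHeight_le (hp : 0 ≤ p) (k : ℕ) :
    ∑ i ∈ Finset.range k, tentHeight p i ≤ tentHeight p k / 63 := by
  induction k with
  | zero => simpa using div_nonneg (tentHeight_pos 0).le (by norm_num)
  | succ k ih =>
    rw [Finset.sum_range_succ]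
    have := tentHeight_succ_ge hp k
    linarith

theorem tent_nonneg (k : ℕ) (x : ZMod (tentPeriod k)) : 0 ≤ tent p k x :=
  mul_nonneg (tentSlope_pos k).le (Nat.cast_nonneg _)

theorem tent_le (k : ℕ) (x : ZMod (tentPeriod k)) : tent p k x ≤ tentHeight p k := by
  rw [← tentSlope_mul_tentLength, tent]
  have := (tentSlope_pos (p := p) k).le
  gcongr
  omega

theorem tent_zero (k : ℕ) : tent p k 0 = tentHeight p k := by
  simp [tent, tentSlope_mul_tentLength]

theorem tent_tentLength (k : ℕ) : tent p k (tentLength k : ZMod (tentPeriod k)) = 0 := by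
  have h := two_mul_tentLength_le k
  rw [tent, ZMod.valMinAbs_natCast_of_le_half (by omega)]
  simp

/-- The tents are Lipschitz for the cyclic distance `x.valMinAbs.natAbs`. -/
theorem abs_tent_add_sub_le (k n : ℕ) (x : ZMod (tentPeriod k)) :
    |tent p k (x + n) - tent p k x| ≤ n * tentSlope p k := by
  have h0 : (n : ZMod (tentPeriod k)).valMinAbs.natAbs ≤ n := by
    rw [ZMod.valMinAbs_natAbs_eq_min]
    exact (min_le_left _ _).trans (by rw [ZMod.val_natCast]; exact Nat.mod_le _ _)
  have h1 := (ZMod.natAbs_valMinAbs_add_le x n).trans (Int.natAbs_add_le _ _)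
  have h2 := (ZMod.natAbs_valMinAbs_add_le (x + (n : ZMod (tentPeriod k)))
    (-(n : ZMod (tentPeriod k)))).trans (Int.natAbs_add_le _ _)
  rw [ZMod.natAbs_valMinAbs_neg, add_neg_cancel_right] at h2
  rw [tent, tent, ← mul_sub, abs_mul, abs_of_pos (tentSlope_pos k), mul_comm]
  refine mul_le_mul_of_nonneg_right ?_ (tentSlope_pos k).le
  generalize (n : ZMod (tentPeriod k)).valMinAbs.natAbs = c at *
  generalize (x + n).valMinAbs.natAbs = a at *
  generalize x.valMinAbs.natAbs = b at *
  rw [abs_le]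
  have h3 : tentLength k - b ≤ n + (tentLength k - a) := by omega
  have h4 : tentLength k - a ≤ n + (tentLength k - b) := by omega
  have h3' : ((tentLength k - b : ℕ) : ℝ) ≤ n + (tentLength k - a : ℕ) := by exact_mod_cast h3
  have h4' : ((tentLength k - a : ℕ) : ℝ) ≤ n + (tentLength k - b : ℕ) := by exact_mod_cast h4
  constructor <;> linarith

theorem abs_tent_sub_le_tentHeight (k : ℕ) (x y : ZMod (tentPeriod k)) :
    |tent p k x - tent p k y| ≤ tentHeight p k := by
  rw [abs_le]
  constructor <;> linarith [tent_le (p := p) k x, tent_le (p := p) k y,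
    tent_nonneg (p := p) k x, tent_nonneg (p := p) k y]

theorem card_tent_ne_zero_le (k : ℕ) :
    Set.ncard {x : ZMod (tentPeriod k) | tent p k x ≠ 0} ≤ 2 * tentLength k := by
  have hsub : Set.MapsTo ZMod.valMinAbs {x : ZMod (tentPeriod k) | tent p k x ≠ 0}
      ((Finset.Ioo (-(tentLength k : ℤ)) (tentLength k) : Finset ℤ) : Set ℤ) := by
    intro x hx
    have : tentLength k - x.valMinAbs.natAbs ≠ 0 := fun h => hx (by simp [tent, h])
    simp only [Finset.coe_Ioo, Set.mem_Ioo]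
    omega
  have := Set.ncard_le_ncard_of_injOn _ hsub ZMod.injective_valMinAbs.injOn
    (Finset.finite_toSet _)
  rw [Set.ncard_coe_finset, Int.card_Ioo] at this
  omega

/-! ### The product of the cyclic groups -/

/-- The phase space of the periodic part: a product of finite cyclic groups. -/
abbrev Phases : Type := ∀ k : ℕ, ZMod (tentPeriod k)

/-- The product of the uniform measures. -/
def phaseMeasure : Measure Phases :=
  Measure.infinitePi fun k => uniformOn (Set.univ : Set (ZMod (tentPeriod k)))

instance (k : ℕ) : IsProbabilityMeasure (uniformOn (Set.univ : Set (ZMod (tentPeriod k)))) :=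
  isProbabilityMeasure_uniformOn Set.finite_univ Set.univ_nonempty

instance : IsProbabilityMeasure phaseMeasure := by unfold phaseMeasure; infer_instance

/-- Translation by `1` in every coordinate. -/
def phaseShift : Phases ≃ᵐ Phases :=
  MeasurableEquiv.piCongrRight fun k =>
    { Equiv.addRight (1 : ZMod (tentPeriod k)) with
      measurable_toFun := measurable_of_finite _
      measurable_invFun := measurable_of_finite _ }

@[simp] theorem phaseShift_apply (x : Phases) (k : ℕ) : phaseShift x k = x k + 1 := rfl

theorem phaseShift_iterate (n : ℕ) (x : Phases) (k : ℕ) : (phaseShift^[n] x) k = x k + n := by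
  induction n with
  | zero => simp
  | succ n ih => rw [Function.iterate_succ_apply', phaseShift_apply, ih]; push_cast; ring

theorem uniformOn_univ_map_equiv {α : Type*} [Fintype α] [Nonempty α] [MeasurableSpace α]
    [MeasurableSingletonClass α] (e : α ≃ α) :
    (uniformOn (Set.univ : Set α)).map e = uniformOn (Set.univ : Set α) := by
  ext s hs
  rw [Measure.map_apply (measurable_of_finite _) hs, uniformOn_univ, uniformOn_univ,
    Measure.count_apply (measurable_of_finite e hs), Measure.count_apply hs]
  congr 2
  exact Set.encard_preimage_of_bijective e.bijective s

theorem measurePreserving_phaseShift : MeasurePreserving phaseShift phaseMeasure phaseMeasure := by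
  refine ⟨phaseShift.measurable, ?_⟩
  have h := Measure.infinitePi_map_pi
    (fun k => uniformOn (Set.univ : Set (ZMod (tentPeriod k))))
    (f := fun k => Equiv.addRight (1 : ZMod (tentPeriod k))) (fun k => measurable_of_finite _)
  simp_rw [uniformOn_univ_map_equiv] at h
  exact h

theorem phaseMeasure_tent_ne_zero_le (k : ℕ) :
    phaseMeasure {x | tent p k (x k) ≠ 0} ≤ ENNReal.ofReal (1 / 2 ^ k) := by
  have h := measurePreserving_eval_infinitePi
    (fun k => uniformOn (Set.univ : Set (ZMod (tentPeriod k)))) k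
  have h1 := h.measure_preimage (s := {x | tent p k x ≠ 0})
    (Set.toFinite _).measurableSet.nullMeasurableSet
  change phaseMeasure _ = _ at h1
  change phaseMeasure (Function.eval k ⁻¹' {x | tent p k x ≠ 0}) ≤ _
  rw [h1, uniformOn_univ, Measure.count_apply (Set.toFinite _).measurableSet, ZMod.card,
    ← (Set.toFinite _).cast_ncard_eq]
  have hN : (0 : ℝ) < tentPeriod k := by exact_mod_cast NeZero.pos (tentPeriod k)
  refine ENNReal.div_le_of_le_mul ?_
  have h2 := card_tent_ne_zero_le (p := p) k
  have h3 : (tentPeriod k : ℝ) = 2 ^ (k + 1) * tentLength k := by simp [tentPeriod]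
  rw [← ENNReal.ofReal_natCast (tentPeriod k), ← ENNReal.ofReal_mul (by positivity), h3]
  have h4 : (1 / 2 ^ k : ℝ) * (2 ^ (k + 1) * tentLength k) = ((2 * tentLength k : ℕ) : ℝ) := by
    rw [pow_succ]; push_cast; field_simp
  rw [h4, ENNReal.ofReal_natCast]
  norm_cast

/-! ### The oscillating part of the process -/

/-- The increment of the tent of level `k` over the first `n` steps of the orbit of `x`. -/
def tentIncrement (p : ℝ) (n k : ℕ) (x : Phases) : ℝ := tent p k (x k + n) - tent p k (x k)

/-- The superposition over all levels `k` of the one-step increments of the tents. -/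
def oscillation (p : ℝ) (x : Phases) : ℝ := ∑' k, (tent p k (x k) - tent p k (x k - 1))

theorem abs_tentIncrement_le (n k : ℕ) (x : Phases) :
    |tentIncrement p n k x| ≤ n * tentSlope p k :=
  abs_tent_add_sub_le k n (x k)

theorem abs_tentIncrement_le_tentHeight (n k : ℕ) (x : Phases) :
    |tentIncrement p n k x| ≤ tentHeight p k :=
  abs_tent_sub_le_tentHeight k _ _

theorem summable_tentIncrement (hp : 1 ≤ p) (n : ℕ) (x : Phases) :
    Summable fun k => tentIncrement p n k x :=
  Summable.of_norm_bounded ((summable_tentSlope hp).mul_left (n : ℝ)) fun k =>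
    abs_tentIncrement_le n k x

theorem measurable_tentIncrement (n k : ℕ) : Measurable (tentIncrement p n k) := by
  have h : Measurable fun y : ZMod (tentPeriod k) => tent p k (y + n) - tent p k y :=
    measurable_of_finite _
  exact h.comp (measurable_pi_apply k)

theorem oscillation_phaseShift (x : Phases) :
    oscillation p (phaseShift x) = ∑' k, tentIncrement p 1 k x := by
  refine tsum_congr fun k => ?_
  simp [tentIncrement]

theorem tentIncrement_add (m n k : ℕ) (x : Phases) :
    tentIncrement p (m + n) k x =
      tentIncrement p m k x + tentIncrement p n k (phaseShift^[m] x) := by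
  simp only [tentIncrement, phaseShift_iterate]
  push_cast
  rw [add_assoc]
  ring

/-- The oscillating part is a superposition of coboundaries, so its partial sums telescope. -/
theorem partialSum_oscillation (hp : 1 ≤ p) (n : ℕ) (x : Phases) :
    partialSum phaseShift (oscillation p) n x = ∑' k, tentIncrement p n k x := by
  induction n with
  | zero => simp [partialSum, tentIncrement]
  | succ n ih =>
    rw [partialSum, Finset.sum_Icc_succ_top (by omega), ← partialSum, ih,
      Function.iterate_succ_apply', oscillation_phaseShift,
      ← (summable_tentIncrement hp n x).tsum_add (summable_tentIncrement hp 1 _)]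
    exact tsum_congr fun k => (tentIncrement_add n 1 k x).symm

theorem partialSum_oscillation_add_sub (hp : 1 ≤ p) (m n : ℕ) (x : Phases) :
    partialSum phaseShift (oscillation p) (m + n) x - partialSum phaseShift (oscillation p) m x =
      ∑' k, tentIncrement p n k (phaseShift^[m] x) := by
  rw [partialSum_oscillation hp, partialSum_oscillation hp,
    ← (summable_tentIncrement hp _ x).tsum_sub (summable_tentIncrement hp _ x)]
  refine tsum_congr fun k => ?_
  rw [tentIncrement_add, add_sub_cancel_left]

theorem abs_oscillation_le (hp : 1 ≤ p) (x : Phases) :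
    |oscillation p x| ≤ ∑' k, tentSlope p k := by
  have h := oscillation_phaseShift (p := p) (phaseShift.symm x)
  rw [MeasurableEquiv.apply_symm_apply] at h
  rw [h, ← Real.norm_eq_abs]
  refine tsum_of_norm_bounded (summable_tentSlope hp).hasSum fun k => ?_
  simpa using abs_tentIncrement_le (p := p) 1 k (phaseShift.symm x)

theorem measurable_tsum_tentIncrement (hp : 1 ≤ p) (n : ℕ) :
    Measurable fun x => ∑' k, tentIncrement p n k x := by
  refine measurable_of_tendsto_metrizable (f := fun K x => ∑ k ∈ Finset.range K,
    tentIncrement p n k x) (fun K => Finset.measurable_fun_sum _ fun k _ =>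
      measurable_tentIncrement n k) ?_
  rw [tendsto_pi_nhds]
  exact fun x => (summable_tentIncrement hp n x).hasSum.tendsto_sum_nat

theorem measurable_oscillation (hp : 1 ≤ p) : Measurable (oscillation p) := by
  have h : oscillation p = (fun x => ∑' k, tentIncrement p 1 k x) ∘ phaseShift.symm := by
    ext x
    rw [Function.comp_apply, ← oscillation_phaseShift, MeasurableEquiv.apply_symm_apply]
  rw [h]
  exact (measurable_tsum_tentIncrement hp 1).comp phaseShift.symm.measurable

theorem phaseMeasure_tentIncrement_ne_zero_le (n k : ℕ) :
    phaseMeasure {x | tentIncrement p n k x ≠ 0} ≤ ENNReal.ofReal (2 / 2 ^ k) := by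
  have h1 := phaseMeasure_tent_ne_zero_le (p := p) k
  have hm : MeasurableSet {x : Phases | tent p k (x k) ≠ 0} := by
    have h : Measurable fun x : Phases => tent p k (x k) :=
      (measurable_of_finite (tent p k)).comp (measurable_pi_apply k)
    exact (h (measurableSet_singleton 0)).compl
  have h2 := (measurePreserving_phaseShift.iterate n).measure_preimage hm.nullMeasurableSet
  have hsub : {x | tentIncrement p n k x ≠ 0} ⊆ {x | tent p k (x k) ≠ 0} ∪
      phaseShift^[n] ⁻¹' {x | tent p k (x k) ≠ 0} := by
    intro x hx
    by_contra h
    simp only [Set.mem_union, Set.mem_preimage, Set.mem_ofPred_eq, not_or, not_not,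
      phaseShift_iterate] at h
    exact hx (by rw [tentIncrement, h.1, h.2, sub_zero])
  calc phaseMeasure {x | tentIncrement p n k x ≠ 0}
      ≤ phaseMeasure {x | tent p k (x k) ≠ 0} +
        phaseMeasure (phaseShift^[n] ⁻¹' {x | tent p k (x k) ≠ 0}) :=
        (measure_mono hsub).trans (measure_union_le _ _)
    _ ≤ ENNReal.ofReal (1 / 2 ^ k) + ENNReal.ofReal (1 / 2 ^ k) := by rw [h2]; gcongr
    _ = ENNReal.ofReal (2 / 2 ^ k) := by
        rw [← ENNReal.ofReal_add (by positivity) (by positivity)]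
        congr 1
        ring

/-- The partial sums of the oscillating part are bounded in probability: those of the levels below
`K` are bounded, and those of the higher levels vanish outside an event of probability at most
`4 / 2 ^ K`. -/
theorem phaseMeasure_partialSum_oscillation_le (hp : 1 ≤ p) (n K : ℕ) :
    phaseMeasure {x | ∑ k ∈ Finset.range K, tentHeight p k <
      |partialSum phaseShift (oscillation p) n x|} ≤ ENNReal.ofReal (4 / 2 ^ K) := by
  have hsub : {x | ∑ k ∈ Finset.range K, tentHeight p k <
      |partialSum phaseShift (oscillation p) n x|} ⊆
      ⋃ i : ℕ, {x | tentIncrement p n (i + K) x ≠ 0} := by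
    intro x hx
    by_contra h
    simp only [Set.mem_iUnion, Set.mem_ofPred_eq, not_exists, not_not] at h hx
    rw [partialSum_oscillation hp, ← (summable_tentIncrement hp n x).sum_add_tsum_nat_add K] at hx
    simp_rw [h] at hx
    rw [tsum_zero, add_zero] at hx
    refine absurd hx (not_lt.2 ((Finset.abs_sum_le_sum_abs _ _).trans ?_))
    exact Finset.sum_le_sum fun k _ => abs_tentIncrement_le_tentHeight n k x
  have hg : ∀ i : ℕ, (2 / 2 ^ (i + K) : ℝ) = 2 / 2 ^ K * (1 / 2) ^ i := fun i => by
    rw [pow_add, one_div, inv_pow]; field_simp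
  have hs : Summable fun i : ℕ => (2 / 2 ^ (i + K) : ℝ) := by
    simp_rw [hg]
    exact summable_geometric_two.mul_left _
  calc phaseMeasure _ ≤ ∑' i : ℕ, phaseMeasure {x | tentIncrement p n (i + K) x ≠ 0} :=
        (measure_mono hsub).trans (measure_iUnion_le _)
    _ ≤ ∑' i : ℕ, ENNReal.ofReal (2 / 2 ^ (i + K)) :=
        ENNReal.tsum_le_tsum fun i => phaseMeasure_tentIncrement_ne_zero_le n (i + K)
    _ = ENNReal.ofReal (4 / 2 ^ K) := by
        rw [← ENNReal.ofReal_tsum_of_nonneg (fun i => by positivity) hs]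
        simp_rw [hg]
        rw [tsum_mul_left, tsum_geometric_two]
        congr 1
        ring

/-! ### Moments of the oscillating part -/

/-- The two-sided geometric sum `∑ min (u, 1 / u)` over a progression of ratio `64` is bounded
uniformly in its starting point: it is dominated by a telescoping sum of `u / (1 + u)`. -/
theorem sum_min_geometric_le {y : ℝ} (hy : 0 < y) (K : ℕ) :
    ∑ k ∈ Finset.range K, min (y / 64 ^ k) (64 ^ k / y) ≤ 3 := by
  let φ : ℝ → ℝ := fun u => u / (1 + u)
  have key : ∀ u : ℝ, 0 < u → min u⁻¹ u ≤ 3 * (φ (64 * u) - φ u) := by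
    intro u hu
    have e : 3 * (φ (64 * u) - φ u) = 189 * u / ((1 + u) * (1 + 64 * u)) := by
      simp only [φ]
      field_simp
      ring
    rw [e, le_div_iff₀ (by positivity)]
    rcases le_total u 1 with h | h
    · calc min u⁻¹ u * ((1 + u) * (1 + 64 * u)) ≤ u * ((1 + u) * (1 + 64 * u)) := by
            gcongr; exact min_le_right _ _
        _ ≤ u * (2 * 65) := by gcongr <;> linarith
        _ ≤ 189 * u := by linarith
    · calc min u⁻¹ u * ((1 + u) * (1 + 64 * u)) ≤ u⁻¹ * ((1 + u) * (1 + 64 * u)) := by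
            gcongr; exact min_le_left _ _
        _ ≤ u⁻¹ * ((2 * u) * (65 * u)) := by gcongr <;> linarith
        _ = 130 * u := by field_simp; norm_num
        _ ≤ 189 * u := by linarith
  have h1 : ∀ k : ℕ, min (y / 64 ^ k) (64 ^ k / y) ≤
      3 * φ (64 ^ (k + 1) / y) - 3 * φ (64 ^ k / y) := by
    intro k
    have := key (64 ^ k / y) (by positivity)
    rw [inv_div, ← mul_div_assoc, ← pow_succ'] at this
    linarith
  refine (Finset.sum_le_sum fun k _ => h1 k).trans ?_
  rw [Finset.sum_range_sub (fun k => 3 * φ (64 ^ k / y))]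
  have h2 : φ (64 ^ K / y) ≤ 1 := by
    simp only [φ]
    have : 0 < (64 : ℝ) ^ K / y := by positivity
    rw [div_le_one (by positivity)]
    linarith
  have h3 : 0 ≤ φ (64 ^ 0 / y) := by simp only [φ]; positivity
  linarith

/-- The height of the tents is balanced against their rarity: up to a constant, the level `k`
contributes `√n` times the smaller of `√(n / L)` and `√(L / n)`, where `L = 4096 ^ k`. -/
theorem eLpNorm_tentIncrement_le (hp : 1 ≤ p) {n : ℕ} (hn : 0 < n) (k : ℕ) :
    eLpNorm (tentIncrement p n k) (ENNReal.ofReal p) phaseMeasure ≤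
      ENNReal.ofReal (4 * √n * min (√n / 64 ^ k) (64 ^ k / √n)) := by
  set c : ℝ := min (n * tentSlope p k) (tentHeight p k) with hc
  have hc0 : 0 ≤ c := le_min (mul_nonneg n.cast_nonneg (tentSlope_pos k).le) (tentHeight_pos k).le
  set s : Set Phases := {x | tentIncrement p n k x ≠ 0} with hs
  have h1 : eLpNorm (tentIncrement p n k) (ENNReal.ofReal p) phaseMeasure ≤
      eLpNorm (s.indicator fun _ => c) (ENNReal.ofReal p) phaseMeasure := by
    refine eLpNorm_mono_real fun x => ?_
    by_cases hx : x ∈ s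
    · rw [Set.indicator_of_mem hx]
      exact le_min (abs_tentIncrement_le n k x) (abs_tentIncrement_le_tentHeight n k x)
    · rw [Set.indicator_of_notMem hx]
      simp only [hs, Set.mem_ofPred_eq, not_not] at hx
      simp [hx]
  refine h1.trans ((eLpNorm_indicator_const_le c _).trans ?_)
  rw [ENNReal.toReal_ofReal (by linarith), Real.enorm_eq_ofReal hc0]
  have hr : 0 < (2 : ℝ) ^ (1 / p) := by positivity
  have hpw : ((2 : ℝ) / 2 ^ k) ^ (1 / p) ≤ 4 / ((2 : ℝ) ^ (1 / p)) ^ (k + 1) := by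
    have e : (2 : ℝ) / 2 ^ k = (2 * 2) / 2 ^ (k + 1) := by rw [pow_succ]; field_simp
    rw [e, Real.div_rpow (by norm_num) (by positivity), Real.mul_rpow zero_le_two zero_le_two,
      ← Real.rpow_natCast, ← Real.rpow_mul zero_le_two, mul_comm _ (1 / p),
      Real.rpow_mul zero_le_two, Real.rpow_natCast]
    gcongr
    have := two_rpow_inv_le_two hp
    nlinarith
  calc ENNReal.ofReal c * phaseMeasure s ^ (1 / p)
      ≤ ENNReal.ofReal c * ENNReal.ofReal (2 / 2 ^ k) ^ (1 / p) := by
        gcongr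
        exact phaseMeasure_tentIncrement_ne_zero_le n k
    _ = ENNReal.ofReal (c * (2 / 2 ^ k) ^ (1 / p)) := by
        rw [ENNReal.ofReal_rpow_of_nonneg (by positivity) (by positivity),
          ENNReal.ofReal_mul hc0]
    _ ≤ _ := by
        refine ENNReal.ofReal_le_ofReal ((mul_le_mul_of_nonneg_left hpw hc0).trans (le_of_eq ?_))
        have hn' : (0 : ℝ) < n := by exact_mod_cast hn
        have hq : √(n : ℝ) * √(n : ℝ) = n := Real.mul_self_sqrt hn'.le
        have e1 : √(n : ℝ) * min (√(n : ℝ) / 64 ^ k) (64 ^ k / √n) =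
            min ((n : ℝ) / 64 ^ k) (64 ^ k) := by
          rw [mul_min_of_nonneg _ _ (Real.sqrt_nonneg _), ← mul_div_assoc, hq,
            mul_div_cancel₀ _ (Real.sqrt_pos.2 hn').ne']
        have e2 : c = ((2 : ℝ) ^ (1 / p)) ^ (k + 1) * min ((n : ℝ) / 64 ^ k) (64 ^ k) := by
          rw [mul_min_of_nonneg _ _ (by positivity), hc, tentSlope_eq, tentHeight,
            mul_div_left_comm, mul_comm (64 ^ k)]
        rw [mul_assoc 4, e1, e2]
        field_simp

theorem eLpNorm_partialSum_oscillation_le (hp : 1 ≤ p) (n : ℕ) :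
    eLpNorm (partialSum phaseShift (oscillation p) n) (ENNReal.ofReal p) phaseMeasure ≤
      ENNReal.ofReal (12 * √n) := by
  rcases Nat.eq_zero_or_pos n with rfl | hn
  · have : partialSum phaseShift (oscillation p) 0 = 0 := by ext; simp [partialSum]
    simp [this]
  have hsq : 0 < √(n : ℝ) := Real.sqrt_pos.2 (by exact_mod_cast hn)
  have hlim := Lp.eLpNorm_lim_le_liminf_eLpNorm (μ := phaseMeasure) (p := ENNReal.ofReal p)
    (f := fun K => ∑ k ∈ Finset.range K, tentIncrement p n k)
    (fun K => Finset.aestronglyMeasurable_sum _ fun k _ =>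
      (measurable_tentIncrement n k).aestronglyMeasurable)
    (partialSum phaseShift (oscillation p) n) (Eventually.of_forall fun x => by
      rw [partialSum_oscillation hp]
      simpa using (summable_tentIncrement hp n x).hasSum.tendsto_sum_nat)
  refine hlim.trans (liminf_le_of_frequently_le' (Frequently.of_forall fun K => ?_))
  refine (eLpNorm_sum_le (fun k _ => (measurable_tentIncrement n k).aestronglyMeasurable)
    (by rw [ENNReal.one_le_ofReal]; exact hp)).trans ?_
  refine (Finset.sum_le_sum fun k _ => eLpNorm_tentIncrement_le hp hn k).trans ?_
  rw [← ENNReal.ofReal_sum_of_nonneg fun k _ => by positivity, ← Finset.mul_sum]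
  refine ENNReal.ofReal_le_ofReal ?_
  have := sum_min_geometric_le hsq K
  nlinarith

/-! ### Large increments of the oscillating part -/

/-- Starting from any phase, within one period of level `k` there is a moment at which the tent of
level `k` begins its descent. The tents of the lower levels are much lower, those of the higher
levels much flatter, so the sum over the next `tentLength k` steps is comparable with
`tentHeight p k`. -/
theorem exists_large_increment_oscillation (hp : 1 ≤ p) (k : ℕ) (x : Phases) :
    ∃ r < tentPeriod k, 3 / 4 * tentHeight p k ≤
      |partialSum phaseShift (oscillation p) (r + tentLength k) x -
        partialSum phaseShift (oscillation p) r x| := by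
  refine ⟨(-x k).val, ZMod.val_lt _, ?_⟩
  rw [partialSum_oscillation_add_sub hp]
  set z := phaseShift^[(-x k).val] x with hz
  have hzk : z k = 0 := by simp [hz, phaseShift_iterate]
  have hmain : tentIncrement p (tentLength k) k z = -tentHeight p k := by
    rw [tentIncrement, hzk, zero_add, tent_tentLength, tent_zero, zero_sub]
  have hsum := summable_tentIncrement hp (tentLength k) z
  rw [← hsum.sum_add_tsum_nat_add (k + 1), Finset.sum_range_succ, hmain]
  have hlow : |∑ i ∈ Finset.range k, tentIncrement p (tentLength k) i z| ≤ tentHeight p k / 63 :=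
    (Finset.abs_sum_le_sum_abs _ _).trans
      ((Finset.sum_le_sum fun i _ => abs_tentIncrement_le_tentHeight _ i z).trans
        (sum_tentHeight_le (by linarith) k))
  have hhigh : |∑' i, tentIncrement p (tentLength k) (i + (k + 1)) z| ≤ tentHeight p k / 31 := by
    have hs := ((summable_nat_add_iff (k + 1)).2 (summable_tentSlope hp)).mul_left
      (tentLength k : ℝ)
    have h1 : ‖∑' i, tentIncrement p (tentLength k) (i + (k + 1)) z‖ ≤ _ :=
      tsum_of_norm_bounded hs.hasSum fun i =>
        abs_tentIncrement_le (p := p) (tentLength k) (i + (k + 1)) z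
    rw [Real.norm_eq_abs, tsum_mul_left] at h1
    refine h1.trans ?_
    rw [← tentSlope_mul_tentLength, mul_comm, mul_div_right_comm]
    gcongr
    exact tsum_tentSlope_tail_le hp k
  -- `3 / 4 ≤ 1 - 1 / 63 - 1 / 31`
  have hH := tentHeight_pos (p := p) k
  rw [abs_le] at hlow hhigh
  rw [le_abs]
  right
  linarith

/-! ### Compact sets of the Hölder space -/

theorem HolderSpace.abs_sub_le_norm_mul {α : ℝ} (x : HolderSpace α) {s t : unitInterval}
    (h0 : 0 < |(t : ℝ) - (s : ℝ)|) (h1 : |(t : ℝ) - (s : ℝ)| < 1) :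
    |x t - x s| ≤ ‖x‖ * |(t : ℝ) - (s : ℝ)| ^ α := by
  have h := HolderSpace.le_modulus x h0 h1
  rw [div_le_iff₀ (by positivity)] at h
  refine h.trans ?_
  gcongr
  rw [HolderSpace.norm_def]
  linarith [abs_nonneg (x 0)]

/-- The modulus `w_α(·, δ)` tends to `0` uniformly on a relatively compact set of Lipschitz paths,
so such a set has no paths with large `α`-Hölder quotients at arbitrarily small scales. -/
theorem HolderSpace.false_of_large_increments {α : ℝ} (hα : α < 1) {K : Set (HolderSpace α)}
    (hK : IsCompact K) {c : ℝ} (hc : 0 < c) {x : ℕ → HolderSpace α} (hxK : ∀ n, x n ∈ K)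
    (hLip : ∀ n, ∃ C : ℝ, ∀ s t : unitInterval, |x n t - x n s| ≤ C * |(t : ℝ) - (s : ℝ)|)
    {δ : ℕ → ℝ} (hδ : Tendsto δ atTop (𝓝 0))
    (hinc : ∀ n, ∃ s t : unitInterval, 0 < |(t : ℝ) - (s : ℝ)| ∧ |(t : ℝ) - (s : ℝ)| = δ n ∧
      c * δ n ^ α ≤ |x n t - x n s|) : False := by
  obtain ⟨a, -, φ, hφ, hlim⟩ := hK.tendsto_subseq hxK
  obtain ⟨N, hN⟩ := Metric.cauchySeq_iff'.1 hlim.cauchySeq (c / 2) (by positivity)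
  obtain ⟨C, hC⟩ := hLip (φ N)
  have hδφ : Tendsto (fun m => δ (φ m)) atTop (𝓝 0) := hδ.comp hφ.tendsto_atTop
  have hpow : Tendsto (fun m => C * δ (φ m) ^ (1 - α)) atTop (𝓝 0) := by
    have h := (Real.continuousAt_rpow_const 0 (1 - α) (Or.inr (by linarith))).tendsto.comp hδφ
    rw [Real.zero_rpow (by linarith)] at h
    simpa using h.const_mul C
  obtain ⟨m, hm1, hm2, hmN⟩ := ((hδφ.eventually_lt_const one_pos).and
    ((hpow.eventually_lt_const (half_pos hc)).and (eventually_ge_atTop N))).exists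
  obtain ⟨s, t, hpos, hst, hle⟩ := hinc (φ m)
  rw [← hst] at hle hm1 hm2
  have h1 := HolderSpace.abs_sub_le_norm_mul (x (φ m) - x (φ N)) hpos hm1
  have h2 : ‖x (φ m) - x (φ N)‖ < c / 2 := by
    rw [← dist_eq_norm]; exact hN m hmN
  have h3 := hC s t
  have h4 : |(t : ℝ) - s| = |(t : ℝ) - s| ^ (1 - α) * |(t : ℝ) - s| ^ α := by
    rw [← Real.rpow_add hpos]; simp
  have h5 : |x (φ m) t - x (φ m) s| ≤
      |x (φ N) t - x (φ N) s| + |(x (φ m) - x (φ N)) t - (x (φ m) - x (φ N)) s| := by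
    refine le_trans (le_of_eq ?_) (abs_add_le _ _)
    simp only [sub_eq_add_neg, HolderSpace.add_apply, HolderSpace.neg_apply]
    congr 1
    ring
  have hq : 0 < |(t : ℝ) - s| ^ α := by positivity
  rw [h4] at h3
  nlinarith

/-! ### Products of dynamical systems -/

section Prod

variable {Ω Ω' : Type*}

theorem partialSum_prodMap (S : Ω → Ω) (T : Ω' → Ω') (f : Ω → ℝ) (g : Ω' → ℝ) (n : ℕ)
    (z : Ω × Ω') :
    partialSum (Prod.map S T) (fun z => f z.1 + g z.2) n z =
      partialSum S f n z.1 + partialSum T g n z.2 := by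
  simp only [partialSum, Prod.map_iterate, Prod.map_fst, Prod.map_snd, Finset.sum_add_distrib]

theorem partialSumProcess_prodMap (S : Ω → Ω) (T : Ω' → Ω') (f : Ω → ℝ) (g : Ω' → ℝ) (n : ℕ)
    (t : ℝ) (z : Ω × Ω') :
    partialSumProcess (Prod.map S T) (fun z => f z.1 + g z.2) n t z =
      partialSumProcess S f n t z.1 + partialSumProcess T g n t z.2 := by
  simp only [partialSumProcess, partialSum_prodMap, Prod.map_iterate, Prod.map_fst, Prod.map_snd]
  ring

theorem partialSumProcess_natCast_div (T : Ω → Ω) (f : Ω → ℝ) {n : ℕ} (hn : 0 < n) (m : ℕ)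
    (ω : Ω) : partialSumProcess T f n ((m : ℝ) / n) ω = (√(n : ℝ))⁻¹ * partialSum T f m ω := by
  have : (n : ℝ) * (m / n) = m := by field_simp
  rw [partialSumProcess, this, Nat.floor_natCast]
  simp

theorem partialSum_add_sub (T : Ω → Ω) (f : Ω → ℝ) (m n : ℕ) (ω : Ω) :
    partialSum T f (m + n) ω - partialSum T f m ω =
      ∑ j ∈ Finset.Ioc m (m + n), f (T^[j] ω) := by
  have h : ∀ k : ℕ, Finset.Icc 1 k = Finset.Ioc 0 k := fun _ => rfl
  rw [partialSum, partialSum, h, h, ← Finset.sum_Ioc_consecutive _ (Nat.zero_le m)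
    (Nat.le_add_right m n), add_sub_cancel_left]

theorem abs_partialSumProcess_le (T : Ω → Ω) {f : Ω → ℝ} {A : ℝ} (hf : ∀ ω, |f ω| ≤ A) (n : ℕ)
    {t : ℝ} (ht : 0 ≤ t) (ω : Ω) :
    abs (partialSumProcess T f n t ω) ≤ (√(n : ℝ))⁻¹ * (|partialSum T f ⌊(n : ℝ) * t⌋₊ ω| + A) := by
  have h1 : (⌊(n : ℝ) * t⌋₊ : ℝ) ≤ n * t := Nat.floor_le (by positivity)
  have h2 : (n : ℝ) * t < ⌊(n : ℝ) * t⌋₊ + 1 := Nat.lt_floor_add_one _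
  rw [partialSumProcess, abs_mul, abs_of_nonneg (by positivity : 0 ≤ (√(n : ℝ))⁻¹)]
  gcongr
  refine (abs_add_le _ _).trans ?_
  gcongr
  rw [abs_mul]
  calc _ ≤ 1 * A := by
        gcongr
        · rw [abs_of_nonneg (by linarith)]; linarith
        · exact hf _
    _ = A := one_mul A

theorem measurable_partialSum [MeasurableSpace Ω] {T : Ω → Ω} (hT : Measurable T) {f : Ω → ℝ}
    (hf : Measurable f) (n : ℕ) : Measurable (partialSum T f n) :=
  Finset.measurable_fun_sum _ fun j _ => hf.comp (hT.iterate j)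

theorem measurable_partialSumProcess [MeasurableSpace Ω] {T : Ω → Ω} (hT : Measurable T)
    {f : Ω → ℝ} (hf : Measurable f) (n : ℕ) (t : ℝ) : Measurable (partialSumProcess T f n t) :=
  ((measurable_partialSum hT hf _).add ((hf.comp (hT.iterate _)).const_mul _)).const_mul _

end Prod

/-! ### The Gaussian shift -/

/-- The law of a two-sided sequence of independent standard Gaussian variables. -/
def gaussianSequence : Measure (ℤ → ℝ) := Measure.infinitePi fun _ => gaussianReal 0 1

instance : IsProbabilityMeasure gaussianSequence := by unfold gaussianSequence; infer_instance

/-- The two-sided shift. -/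
def sequenceShift : (ℤ → ℝ) ≃ᵐ (ℤ → ℝ) where
  toFun ω i := ω (i + 1)
  invFun ω i := ω (i - 1)
  left_inv ω := by simp
  right_inv ω := by simp
  measurable_toFun := by
    change Measurable fun (ω : ℤ → ℝ) i => ω (i + 1)
    fun_prop
  measurable_invFun := by
    change Measurable fun (ω : ℤ → ℝ) i => ω (i - 1)
    fun_prop

@[simp] theorem sequenceShift_apply (ω : ℤ → ℝ) (i : ℤ) : sequenceShift ω i = ω (i + 1) := rfl

theorem sequenceShift_iterate (n : ℕ) (ω : ℤ → ℝ) (i : ℤ) :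
    (sequenceShift^[n] ω) i = ω (i + n) := by
  induction n generalizing i with
  | zero => simp
  | succ n ih =>
    rw [Function.iterate_succ_apply', sequenceShift_apply, ih]
    push_cast
    congr 1
    ring

theorem measurePreserving_sequenceShift :
    MeasurePreserving sequenceShift gaussianSequence gaussianSequence :=
  ⟨sequenceShift.measurable, Measure.map_infinitePi_infinitePi_of_inj
    (P := fun _ : ℤ => gaussianReal 0 1) (f := fun i : ℤ => i + 1) (add_left_injective 1)⟩

theorem hasLaw_sequenceShift_iterate (j : ℕ) :
    HasLaw (fun ω => (sequenceShift^[j] ω) 0) (gaussianReal 0 1) gaussianSequence := by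
  simp_rw [sequenceShift_iterate]
  exact (measurePreserving_eval_infinitePi (fun _ : ℤ => gaussianReal 0 1) _).hasLaw

theorem iIndepFun_sequenceShift_iterate :
    iIndepFun (fun (j : ℕ) ω => (sequenceShift^[j] ω) 0) gaussianSequence := by
  simp_rw [sequenceShift_iterate]
  have h := iIndepFun_infinitePi (P := fun _ : ℤ => gaussianReal 0 1) (X := fun _ x => x)
    (fun _ => measurable_id)
  exact h.precomp (g := fun j : ℕ => (0 : ℤ) + j) fun a b hab => by simpa using hab

/-! ### The product system -/

/-- The product of the Gaussian shift with the translation of the phases. -/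
def productShift : ((ℤ → ℝ) × Phases) ≃ᵐ ((ℤ → ℝ) × Phases) :=
  sequenceShift.prodCongr phaseShift

/-- The invariant product measure. -/
abbrev productMeasure : Measure ((ℤ → ℝ) × Phases) := gaussianSequence.prod phaseMeasure

/-- White noise plus the oscillating part. -/
def noisyOscillation (p : ℝ) (z : (ℤ → ℝ) × Phases) : ℝ := z.1 0 + oscillation p z.2

theorem coe_productShift : ⇑productShift = Prod.map sequenceShift phaseShift := rfl

theorem measurePreserving_productShift :
    MeasurePreserving productShift productMeasure productMeasure :=
  measurePreserving_sequenceShift.prod measurePreserving_phaseShift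

theorem measurable_noisyOscillation (hp : 1 ≤ p) : Measurable (noisyOscillation p) :=
  ((measurable_pi_apply (0 : ℤ)).comp measurable_fst).add
    ((measurable_oscillation hp).comp measurable_snd)

theorem partialSum_noisyOscillation (n : ℕ) (z : (ℤ → ℝ) × Phases) :
    partialSum productShift (noisyOscillation p) n z =
      partialSum sequenceShift (fun ω => ω 0) n z.1 +
        partialSum phaseShift (oscillation p) n z.2 :=
  partialSum_prodMap _ _ (fun ω : ℤ → ℝ => ω 0) (oscillation p) n z

/-! ### Finite-dimensional distributions -/

/-- Partial sums which are bounded in probability disappear after division by `√n`. -/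
theorem tendstoInMeasure_partialSumProcess_oscillation (hp : 1 ≤ p) (I : Finset ℝ≥0) :
    TendstoInMeasure productMeasure
      (fun (n : ℕ) (z : (ℤ → ℝ) × Phases) (t : I) =>
        partialSumProcess phaseShift (oscillation p) n (t : ℝ≥0) z.2)
      atTop (fun _ => 0) := by
  rw [tendstoInMeasure_iff_norm]
  intro ε hε
  rw [ENNReal.tendsto_atTop_zero]
  intro η hη
  have hK : Tendsto (fun K : ℕ => (I.card : ℝ≥0∞) * ENNReal.ofReal (4 / 2 ^ K)) atTop (𝓝 0) := by
    have h1 : Tendsto (fun K : ℕ => (4 / 2 ^ K : ℝ)) atTop (𝓝 0) := by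
      have := (tendsto_pow_atTop_nhds_zero_of_lt_one (r := (1 / 2 : ℝ)) (by norm_num)
        (by norm_num)).const_mul 4
      rw [mul_zero] at this
      refine this.congr fun K => ?_
      rw [one_div, inv_pow, div_eq_mul_inv]
    have h2 := ENNReal.tendsto_ofReal h1
    rw [ENNReal.ofReal_zero] at h2
    have h3 := ENNReal.Tendsto.const_mul (a := (I.card : ℝ≥0∞)) h2
      (Or.inr (ENNReal.natCast_ne_top _))
    rwa [mul_zero] at h3
  -- `K` makes the levels from `K` on improbable; then a large `n` makes the contribution of the
  -- lower levels, bounded by `B`, small.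
  obtain ⟨K, hKη⟩ := (hK.eventually_le_const hη).exists
  set B : ℝ := ∑ k ∈ Finset.range K, tentHeight p k + ∑' k, tentSlope p k with hB
  have hlim : Tendsto (fun n : ℕ => (√(n : ℝ))⁻¹ * B) atTop (𝓝 0) := by
    have h := (tendsto_inv_atTop_zero.comp
      (Real.tendsto_sqrt_atTop.comp tendsto_natCast_atTop_atTop)).mul_const B
    rw [zero_mul] at h
    exact h
  obtain ⟨N, hN⟩ := eventually_atTop.1 (hlim.eventually_lt_const hε)
  refine ⟨N, fun n hn => ?_⟩
  let bad : I → Set Phases := fun t => {x | ∑ k ∈ Finset.range K, tentHeight p k <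
    |partialSum phaseShift (oscillation p) ⌊(n : ℝ) * (t : ℝ≥0)⌋₊ x|}
  have hsub : {z : (ℤ → ℝ) × Phases | ε ≤ ‖(fun (t : I) =>
      partialSumProcess phaseShift (oscillation p) n (t : ℝ≥0) z.2) - 0‖} ⊆
      ⋃ t : I, Prod.snd ⁻¹' bad t := by
    intro z hz
    by_contra h
    simp only [bad, Set.mem_iUnion, Set.mem_preimage, Set.mem_ofPred_eq, not_exists, not_lt] at h hz
    refine absurd hz (not_le.2 ?_)
    rw [sub_zero, pi_norm_lt_iff hε]
    intro t
    refine lt_of_le_of_lt ?_ (hN n hn)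
    rw [Real.norm_eq_abs]
    refine (abs_partialSumProcess_le phaseShift (abs_oscillation_le hp) n (t : ℝ≥0).2 z.2).trans ?_
    rw [hB]
    gcongr
    exact h t
  calc productMeasure _ ≤ productMeasure (⋃ t : I, Prod.snd ⁻¹' bad t) := measure_mono hsub
    _ ≤ ∑ t : I, productMeasure (Prod.snd ⁻¹' bad t) := measure_iUnion_fintype_le _ _
    _ ≤ ∑ t : I, ENNReal.ofReal (4 / 2 ^ K) := by
        refine Finset.sum_le_sum fun t _ => ?_
        have hm : MeasurableSet (bad t) := measurableSet_lt measurable_const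
          (measurable_partialSum phaseShift.measurable (measurable_oscillation hp) _).abs
        rw [measurePreserving_snd.measure_preimage hm.nullMeasurableSet]
        exact phaseMeasure_partialSum_oscillation_le hp _ K
    _ = I.card * ENNReal.ofReal (4 / 2 ^ K) := by simp
    _ ≤ η := hKη

theorem finiteDimTendstoBrownian_noisyOscillation (hp : 1 ≤ p) :
    FiniteDimTendstoBrownian productMeasure productShift (noisyOscillation p) := by
  have hpre : ∀ (j : ℕ) (z : (ℤ → ℝ) × Phases),
      (productShift^[j] z).1 0 = (sequenceShift^[j] z.1) 0 := fun j z => by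
    rw [coe_productShift, Prod.map_iterate, Prod.map_fst]
  have hfst := measurePreserving_fst (μ := gaussianSequence) (ν := phaseMeasure)
  have hlaw : ∀ j : ℕ, HasLaw (fun z : (ℤ → ℝ) × Phases => (productShift^[j] z).1 0)
      (gaussianReal 0 1) productMeasure := fun j => by
    simp_rw [hpre]
    exact (hasLaw_sequenceShift_iterate j).comp hfst.hasLaw
  have hind : iIndepFun (fun (j : ℕ) (z : (ℤ → ℝ) × Phases) => (productShift^[j] z).1 0)
      productMeasure := by
    simp_rw [hpre]
    have h := iIndepFun_sequenceShift_iterate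
    have hm : Measurable fun (ω : ℤ → ℝ) (j : ℕ) => (sequenceShift^[j] ω) 0 :=
      measurable_pi_lambda _ fun j =>
        (measurable_pi_apply _).comp (sequenceShift.measurable.iterate j)
    rw [iIndepFun_iff_hasLaw_Pi_infinitePi hasLaw_sequenceShift_iterate hm.aemeasurable] at h
    exact (iIndepFun_iff_hasLaw_Pi_infinitePi
      (fun j => (hasLaw_sequenceShift_iterate j).comp hfst.hasLaw)
      (hm.comp measurable_fst).aemeasurable).2 (h.comp hfst.hasLaw)
  intro I hI
  have hG := finiteDimTendstoBrownian_of_gaussian productMeasure productShift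
    (fun z => z.1 0) hlaw hind I hI
  have hsum := hG.add_of_tendstoInMeasure_const
    (tendstoInMeasure_partialSumProcess_oscillation hp I) fun n =>
      (measurable_pi_lambda _ fun t => (measurable_partialSumProcess phaseShift.measurable
        (measurable_oscillation hp) n _).comp measurable_snd).aemeasurable
  refine hsum.congr (fun n => Eventually.of_forall fun z => ?_)
    (Eventually.of_forall fun y => by simp)
  ext t
  simp only [Pi.add_apply]
  have h1 := partialSumProcess_prodMap sequenceShift phaseShift (fun ω : ℤ → ℝ => ω 0)
    (oscillation p) n (t : ℝ≥0) z
  have h2 := partialSumProcess_prodMap sequenceShift phaseShift (fun ω : ℤ → ℝ => ω 0)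
    (fun _ => 0) n (t : ℝ≥0) z
  have h3 : partialSumProcess phaseShift (fun _ => (0 : ℝ)) n (t : ℝ≥0) z.2 = 0 := by
    simp [partialSumProcess, partialSum]
  simp only [add_zero, h3] at h2
  rw [coe_productShift, h2]
  exact h1.symm

/-! ### Moments -/

theorem integral_oscillation (hp : 1 ≤ p) : ∫ x, oscillation p x ∂phaseMeasure = 0 := by
  have hbound : ∀ k x, ‖tentIncrement p 1 k x‖ ≤ tentSlope p k := fun k x => by
    simpa using abs_tentIncrement_le (p := p) 1 k x
  have hint : ∀ k, Integrable (tentIncrement p 1 k) phaseMeasure := fun k =>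
    Integrable.of_bound (measurable_tentIncrement 1 k).aestronglyMeasurable _
      (Eventually.of_forall (hbound k))
  have hzero : ∀ k, ∫ x, tentIncrement p 1 k x ∂phaseMeasure = 0 := fun k => by
    have hm : Measurable fun x : Phases => tent p k (x k) :=
      (measurable_of_finite (tent p k)).comp (measurable_pi_apply k)
    have hi : Integrable (fun x : Phases => tent p k (x k)) phaseMeasure :=
      Integrable.of_bound hm.aestronglyMeasurable (tentHeight p k)
        (Eventually.of_forall fun x => by
          rw [Real.norm_of_nonneg (tent_nonneg k _)]; exact tent_le k _)
    have hi' := (measurePreserving_phaseShift.integrable_comp hi.aestronglyMeasurable).2 hi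
    have h := measurePreserving_phaseShift.integral_comp' (fun x => tent p k (x k))
    have e : tentIncrement p 1 k = fun x => tent p k (phaseShift x k) - tent p k (x k) := by
      ext x; simp [tentIncrement]
    rw [e]
    exact (integral_sub hi' hi).trans (by rw [sub_eq_zero]; exact h)
  rw [← measurePreserving_phaseShift.integral_comp' (oscillation p)]
  simp_rw [oscillation_phaseShift]
  rw [← integral_tsum_of_summable_integral_norm hint]
  · simp [hzero]
  · refine Summable.of_nonneg_of_le (fun k => by positivity) (fun k => ?_) (summable_tentSlope hp)
    calc ∫ x, ‖tentIncrement p 1 k x‖ ∂phaseMeasure ≤ ∫ _, tentSlope p k ∂phaseMeasure :=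
          integral_mono (hint k).norm (integrable_const _) (hbound k)
      _ = tentSlope p k := by simp

theorem memLp_oscillation (hp : 1 ≤ p) (q : ℝ≥0∞) : MemLp (oscillation p) q phaseMeasure :=
  MemLp.of_bound (measurable_oscillation hp).aestronglyMeasurable _
    (Eventually.of_forall (abs_oscillation_le hp))

theorem memLp_gaussianSequence_eval (q : ℝ≥0) :
    MemLp (fun ω : ℤ → ℝ => ω 0) q gaussianSequence :=
  (memLp_id_gaussianReal q).comp_measurePreserving
    (measurePreserving_eval_infinitePi (fun _ : ℤ => gaussianReal 0 1) 0)

theorem memLp_noisyOscillation (hp : 1 ≤ p) (q : ℝ≥0) :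
    MemLp (noisyOscillation p) q productMeasure :=
  ((memLp_gaussianSequence_eval q).comp_measurePreserving measurePreserving_fst).add
    ((memLp_oscillation hp q).comp_measurePreserving measurePreserving_snd)

theorem integral_noisyOscillation (hp : 1 ≤ p) :
    ∫ z, noisyOscillation p z ∂productMeasure = 0 := by
  have h1 : Integrable (fun ω : ℤ → ℝ => ω 0) gaussianSequence :=
    memLp_one_iff_integrable.1 (memLp_gaussianSequence_eval 1)
  have h2 : Integrable (oscillation p) phaseMeasure :=
    memLp_one_iff_integrable.1 (memLp_oscillation hp 1)
  have h3 : ∫ ω : ℤ → ℝ, ω 0 ∂gaussianSequence = 0 := by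
    have := (hasLaw_sequenceShift_iterate 0).integral_eq
    rw [integral_id_gaussianReal] at this
    exact this
  simp only [noisyOscillation]
  rw [integral_add (h1.comp_fst _) (h2.comp_snd _), integral_fun_fst (fun ω : ℤ → ℝ => ω 0),
    integral_fun_snd, h3, integral_oscillation hp]
  simp

/-- `S_n` of the white noise has the law of `√n` times a standard Gaussian variable. -/
theorem eLpNorm_partialSum_sequenceShift (q : ℝ≥0) (n : ℕ) :
    eLpNorm (partialSum sequenceShift (fun ω => ω 0) n) q gaussianSequence =
      ENNReal.ofReal √n * eLpNorm id q (gaussianReal 0 1) := by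
  have h := hasLaw_sum_gaussian hasLaw_sequenceShift_iterate iIndepFun_sequenceShift_iterate
    (Finset.Icc 1 n)
  rw [Nat.card_Icc, Nat.add_sub_cancel] at h
  have h1 : eLpNorm (partialSum sequenceShift (fun ω => ω 0) n) q gaussianSequence =
      eLpNorm id q (gaussianReal 0 n) := by
    rw [← h.map_eq, eLpNorm_map_measure (by fun_prop) h.aemeasurable]
    rfl
  have h2 : gaussianReal 0 n = (gaussianReal 0 1).map (√(n : ℝ) * ·) := by
    rw [gaussianReal_map_const_mul, mul_zero, mul_one]
    congr 1
    ext
    simp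
  rw [h1, h2, eLpNorm_map_measure (by fun_prop) (by fun_prop)]
  have h3 : (id ∘ fun x : ℝ => √(n : ℝ) * x) = √(n : ℝ) • id := by ext; simp
  rw [h3, eLpNorm_const_smul, Real.enorm_eq_ofReal (Real.sqrt_nonneg _)]

theorem exists_integral_partialSum_noisyOscillation_le (hp : 1 ≤ p) :
    ∃ C : ℝ, ∀ n : ℕ, 1 ≤ n →
      (∫ z, |partialSum productShift (noisyOscillation p) n z| ^ p ∂productMeasure) /
        (n : ℝ) ^ (p / 2) ≤ C := by
  have hp0 : 0 < p := by linarith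
  set q : ℝ≥0 := ⟨p, hp0.le⟩ with hq
  have hqp : ENNReal.ofReal p = q := by
    rw [ENNReal.ofReal]; congr; exact Real.toNNReal_of_nonneg hp0.le
  set m : ℝ := (eLpNorm id q (gaussianReal 0 1)).toReal with hm
  have hm' : eLpNorm id q (gaussianReal 0 1) = ENNReal.ofReal m :=
    (ENNReal.ofReal_toReal (memLp_id_gaussianReal q).eLpNorm_ne_top).symm
  have hm0 : 0 ≤ m := ENNReal.toReal_nonneg
  refine ⟨(m + 12) ^ p, fun n hn => ?_⟩
  have hn' : (0 : ℝ) < n := by exact_mod_cast hn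
  have hG := (measurable_partialSum sequenceShift.measurable
    (measurable_pi_apply (0 : ℤ) : Measurable fun ω : ℤ → ℝ => ω 0) n).aestronglyMeasurable
    (μ := gaussianSequence)
  have hO := (measurable_partialSum phaseShift.measurable
    (measurable_oscillation hp) n).aestronglyMeasurable (μ := phaseMeasure)
  have hS : partialSum productShift (noisyOscillation p) n =
      partialSum sequenceShift (fun ω => ω 0) n ∘ Prod.fst +
        partialSum phaseShift (oscillation p) n ∘ Prod.snd := by
    ext z
    exact partialSum_noisyOscillation n z
  have hle : eLpNorm (partialSum productShift (noisyOscillation p) n) q productMeasure ≤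
      ENNReal.ofReal ((m + 12) * √n) := by
    rw [hS]
    refine (eLpNorm_add_le (hG.comp_measurePreserving measurePreserving_fst)
      (hO.comp_measurePreserving measurePreserving_snd) (by exact_mod_cast hp)).trans ?_
    rw [eLpNorm_comp_measurePreserving hG measurePreserving_fst,
      eLpNorm_comp_measurePreserving hO measurePreserving_snd,
      eLpNorm_partialSum_sequenceShift, hm', ← ENNReal.ofReal_mul (Real.sqrt_nonneg _), ← hqp]
    refine (add_le_add_right (eLpNorm_partialSum_oscillation_le hp n) _).trans ?_
    rw [← ENNReal.ofReal_add (by positivity) (by positivity)]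
    exact ENNReal.ofReal_le_ofReal (by linarith)
  have hmem : MemLp (partialSum productShift (noisyOscillation p) n) q productMeasure :=
    ⟨(measurable_partialSum productShift.measurable
      (measurable_noisyOscillation hp) n).aestronglyMeasurable, hle.trans_lt ENNReal.ofReal_lt_top⟩
  have hq0 : (q : ℝ≥0∞) ≠ 0 := by
    rw [← hqp]; exact (ENNReal.ofReal_pos.2 hp0).ne'
  rw [hmem.eLpNorm_eq_integral_rpow_norm hq0 ENNReal.coe_ne_top, ENNReal.coe_toReal,
    ENNReal.ofReal_le_ofReal_iff (by positivity)] at hle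
  have hqr : (q : ℝ) = p := rfl
  simp only [hqr, Real.norm_eq_abs] at hle
  have hint : 0 ≤ ∫ z, |partialSum productShift (noisyOscillation p) n z| ^ p ∂productMeasure := by
    positivity
  rw [div_le_iff₀ (by positivity)]
  calc ∫ z, |partialSum productShift (noisyOscillation p) n z| ^ p ∂productMeasure
      = ((∫ z, |partialSum productShift (noisyOscillation p) n z| ^ p ∂productMeasure) ^ p⁻¹) ^ p :=
        (Real.rpow_inv_rpow hint hp0.ne').symm
    _ ≤ ((m + 12) * √n) ^ p := by gcongr
    _ = (m + 12) ^ p * (n : ℝ) ^ (p / 2) := by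
        rw [Real.mul_rpow (by positivity) (by positivity), Real.sqrt_eq_rpow,
          ← Real.rpow_mul hn'.le]
        congr 2
        ring

/-! ### Lack of tightness in the Hölder space -/

/-- The Gaussian part is negligible: over `tentLength k` steps its increments are of order
`√(tentLength k)`, which is much less than `tentHeight p k`. -/
theorem gaussianSequence_large_increment_le (hp : 1 ≤ p) :
    ∃ k₀, ∀ k ≥ k₀, ∀ r : ℕ, gaussianSequence {ω | tentHeight p k / 4 ≤
      |partialSum sequenceShift (fun ω => ω 0) (r + tentLength k) ω -
        partialSum sequenceShift (fun ω => ω 0) r ω|} ≤ ENNReal.ofReal (1 / 2) := by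
  -- Chebyshev's inequality gives `16 / R ^ 2` with `R = (2 ^ (1 / p)) ^ (k + 1)`.
  have hρ : 1 < (2 : ℝ) ^ (1 / p) := Real.one_lt_rpow one_lt_two (by positivity)
  obtain ⟨k₀, hk₀⟩ := eventually_atTop.1
    ((tendsto_pow_atTop_atTop_of_one_lt hρ).eventually_ge_atTop 32)
  refine ⟨k₀, fun k hk r => ?_⟩
  simp_rw [partialSum_add_sub]
  have h := hasLaw_sum_gaussian hasLaw_sequenceShift_iterate iIndepFun_sequenceShift_iterate
    (Finset.Ioc r (r + tentLength k))
  have hmem : MemLp (fun ω : ℤ → ℝ => ∑ j ∈ Finset.Ioc r (r + tentLength k),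
      (sequenceShift^[j] ω) 0) 2 gaussianSequence := h.hasGaussianLaw.memLp_two
  have hH := tentHeight_pos (p := p) k
  have hcheb := meas_ge_le_variance_div_sq hmem (c := tentHeight p k / 4) (by positivity)
  rw [h.integral_eq, integral_id_gaussianReal, h.variance_eq, variance_id_gaussianReal] at hcheb
  simp only [sub_zero, Nat.card_Ioc, Nat.add_sub_cancel_left, NNReal.coe_natCast] at hcheb
  refine hcheb.trans (ENNReal.ofReal_le_ofReal ?_)
  have hL : (tentLength k : ℝ) = 64 ^ k * 64 ^ k := by
    rw [tentLength, ← mul_pow]; norm_num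
  have hR : 32 ≤ ((2 : ℝ) ^ (1 / p)) ^ (k + 1) := hk₀ (k + 1) (by omega)
  rw [hL, tentHeight, div_le_div_iff₀ (by positivity) two_pos]
  set R : ℝ := ((2 : ℝ) ^ (1 / p)) ^ (k + 1)
  have h1 : (32 : ℝ) ≤ R * R := by nlinarith
  have h2 : (0 : ℝ) < 64 ^ k * 64 ^ k := by positivity
  nlinarith

/-- The normalization by `√n` and by the Hölder scale `(L / n) ^ (1 / 2 - 1 / p)` turns
`tentHeight p k` into a constant when `n` is two periods of level `k` and `L = tentLength k`. -/
theorem mul_rpow_le_tentHeight (hp : 2 < p) (k : ℕ) :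
    1 / 4 * ((1 : ℝ) / 2 ^ (k + 2)) ^ (1 / 2 - 1 / p) ≤
      (√((2 * tentPeriod k : ℕ) : ℝ))⁻¹ * (tentHeight p k / 2) := by
  have hr := two_rpow_inv_le_two (p := p) (by linarith)
  have hr0 : 0 < (2 : ℝ) ^ (1 / p) := by positivity
  have hn : √((2 * tentPeriod k : ℕ) : ℝ) = √(2 ^ (k + 2)) * 64 ^ k := by
    have : ((2 * tentPeriod k : ℕ) : ℝ) = 2 ^ (k + 2) * (64 ^ k) ^ 2 := by
      rw [tentPeriod, tentLength]
      push_cast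
      rw [← pow_mul, mul_comm k 2, pow_mul (64 : ℝ) 2 k, pow_succ _ (k + 1)]
      norm_num
      ring
    rw [this, Real.sqrt_mul (by positivity), Real.sqrt_sq (by positivity)]
  have hδ : ((1 : ℝ) / 2 ^ (k + 2)) ^ (1 / 2 - 1 / p) =
      (√(2 ^ (k + 2)))⁻¹ * ((2 : ℝ) ^ (1 / p)) ^ (k + 2) := by
    rw [one_div ((2 : ℝ) ^ (k + 2)), Real.inv_rpow (by positivity),
      Real.rpow_sub (by positivity), inv_div, ← Real.sqrt_eq_rpow, div_eq_inv_mul]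
    congr 1
    rw [← Real.rpow_natCast, ← Real.rpow_mul zero_le_two, mul_comm, Real.rpow_mul zero_le_two,
      Real.rpow_natCast]
  rw [hn, hδ, tentHeight, pow_succ ((2 : ℝ) ^ (1 / p)) (k + 1)]
  have hq : 0 < √((2 : ℝ) ^ (k + 2)) := by positivity
  have e : (√(2 ^ (k + 2)) * 64 ^ k)⁻¹ * (64 ^ k * ((2 : ℝ) ^ (1 / p)) ^ (k + 1) / 2) =
      (√(2 ^ (k + 2)))⁻¹ * (((2 : ℝ) ^ (1 / p)) ^ (k + 1) / 2) := by field_simp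
  rw [e, mul_left_comm]
  have hpos : 0 < ((2 : ℝ) ^ (1 / p)) ^ (k + 1) := by positivity
  gcongr
  nlinarith

/-- A compact set carrying most of the mass of every law would contain, for all large `k`, a path
with a large increment on the scale `1 / 2 ^ (k + 2)`, which is `tentLength k` steps out of two
periods. -/
theorem not_isTightMeasureSet_noisyOscillation (hp : 2 < p) :
    ¬ IsTightMeasureSet {ν : Measure (HolderSpace (1 / 2 - 1 / p)) |
      ∃ n : ℕ, 1 ≤ n ∧ ν = productMeasure.map
        (holderPartialSumProcess (half_sub_inv_le_one hp) productShift
          (noisyOscillation p) n)} := by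
  intro htight
  have hp1 : 1 ≤ p := by linarith
  obtain ⟨K, hK, hKle⟩ := isTightMeasureSet_iff_exists_isCompact_measure_compl_le.1 htight
    (ENNReal.ofReal (1 / 4)) (by simp)
  obtain ⟨k₀, hk₀⟩ := gaussianSequence_large_increment_le hp1
  have key : ∀ m : ℕ, ∃ z : (ℤ → ℝ) × Phases,
      holderPartialSumProcess (half_sub_inv_le_one hp) productShift (noisyOscillation p)
        (2 * tentPeriod (k₀ + m)) z ∈ K ∧
      ∃ r < tentPeriod (k₀ + m), tentHeight p (k₀ + m) / 2 ≤
        |partialSum productShift (noisyOscillation p) (r + tentLength (k₀ + m)) z -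
          partialSum productShift (noisyOscillation p) r z| := by
    intro m
    set k := k₀ + m
    have hN : 1 ≤ 2 * tentPeriod k := by have := NeZero.pos (tentPeriod k); omega
    have hmeas := measurable_holderPartialSumProcess (half_sub_inv_le_one hp)
      productShift.measurable (measurable_noisyOscillation hp1) (2 * tentPeriod k)
    have hS := hmeas hK.isClosed.measurableSet.compl
    have h1 := hKle _ ⟨2 * tentPeriod k, hN, rfl⟩
    rw [Measure.map_apply hmeas hK.isClosed.measurableSet.compl, Measure.prod_apply_symm hS] at h1
    -- Fixing a good phase first makes the place of the descent deterministic, so that the bound on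
    -- the Gaussian increments applies there.
    obtain ⟨x, hx⟩ := exists_le_lintegral (μ := phaseMeasure)
      (measurable_measure_prodMk_right hS (μ := gaussianSequence)).aemeasurable
    obtain ⟨r, hr, hinc⟩ := exists_large_increment_oscillation hp1 k x
    have h2 := hk₀ k (Nat.le_add_right _ _) r
    have hlt : ENNReal.ofReal (1 / 4) + ENNReal.ofReal (1 / 2) < 1 := by
      rw [← ENNReal.ofReal_add (by norm_num) (by norm_num), ENNReal.ofReal_lt_one]
      norm_num
    have h3 := (measure_union_le _ _).trans_lt ((add_le_add (hx.trans h1) h2).trans_lt hlt)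
    rw [← measure_univ (μ := gaussianSequence)] at h3
    obtain ⟨ω, hω⟩ := (Set.ne_univ_iff_exists_notMem _).1 fun h => h3.ne (congrArg _ h)
    simp only [Set.mem_union, Set.mem_preimage, Set.mem_compl_iff, Set.mem_ofPred_eq, not_or,
      not_not, not_le] at hω
    refine ⟨(ω, x), hω.1, r, hr, ?_⟩
    rw [partialSum_noisyOscillation, partialSum_noisyOscillation]
    have h4 := hω.2
    rw [abs_lt] at h4
    rw [le_abs] at hinc ⊢
    rcases hinc with h | h
    · left; dsimp only; linarith
    · right; dsimp only; linarith
  choose z hzK r hr hinc using key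
  refine HolderSpace.false_of_large_increments (α := 1 / 2 - 1 / p) ?_ hK
    (c := 1 / 4) (by norm_num) hzK (fun m => ?_)
    (δ := fun m => (1 : ℝ) / 2 ^ (k₀ + m + 2)) ?_ (fun m => ?_)
  · have : 0 < 1 / p := by positivity
    linarith
  · obtain ⟨C, hC⟩ := partialSumProcess_mem (le_refl (1 : ℝ)) productShift (noisyOscillation p)
      (2 * tentPeriod (k₀ + m)) (z m)
    refine ⟨C, fun s t => ?_⟩
    rcases eq_or_ne s t with rfl | hst
    · simp
    · have h := hC s t hst
      have hpos : 0 < |(t : ℝ) - (s : ℝ)| :=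
        abs_pos.2 (sub_ne_zero.2 fun he => hst (Subtype.ext he.symm))
      rw [Real.rpow_one, div_le_iff₀ hpos] at h
      exact h
  · have h := (tendsto_pow_atTop_nhds_zero_of_lt_one (r := (1 / 2 : ℝ)) (by norm_num)
      (by norm_num)).comp (tendsto_atTop_mono (fun m => (by omega : m ≤ k₀ + m + 2)) tendsto_id)
    refine h.congr fun m => ?_
    simp
  · set k := k₀ + m
    set n := 2 * tentPeriod k with hn
    have hNpos : 0 < tentPeriod k := NeZero.pos _
    have hnpos : 0 < n := by omega
    have hn' : (0 : ℝ) < n := by exact_mod_cast hnpos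
    have hmem : ∀ i ≤ n, ((i : ℝ) / n) ∈ Set.Icc (0 : ℝ) 1 := fun i hi =>
      ⟨by positivity, by rw [div_le_one hn']; exact_mod_cast hi⟩
    have hL := two_mul_tentLength_le k
    have hrm : r m < tentPeriod k := hr m
    have hdist : |((r m + tentLength k : ℕ) : ℝ) / n - (r m : ℝ) / n| = 1 / 2 ^ (k + 2) := by
      have hL0 : (0 : ℝ) < tentLength k := by exact_mod_cast tentLength_pos k
      rw [← sub_div]
      push_cast
      rw [add_sub_cancel_left, abs_of_pos (by positivity), hn, tentPeriod]
      push_cast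
      rw [pow_succ _ (k + 1)]
      field_simp
    refine ⟨⟨_, hmem (r m) (by omega)⟩, ⟨_, hmem (r m + tentLength k) (by omega)⟩, ?_, hdist, ?_⟩
    · rw [hdist]; positivity
    · refine (mul_rpow_le_tentHeight hp k).trans ?_
      change _ ≤ abs (partialSumProcess _ _ n _ _ - partialSumProcess _ _ n _ _)
      rw [partialSumProcess_natCast_div _ _ hnpos, partialSumProcess_natCast_div _ _ hnpos,
        ← mul_sub, abs_mul, abs_of_nonneg (by positivity : 0 ≤ (√(n : ℝ))⁻¹)]
      gcongr
      exact hinc m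

end

end HolderWIP

theorem theorem2p6 (p : ℝ) (hp : 2 < p) :
    ∃ (Ω : Type) (_ : MeasurableSpace Ω) (μ : Measure Ω) (_ : IsProbabilityMeasure μ)
      (T : Ω ≃ᵐ Ω) (f : Ω → ℝ),
      MeasurePreserving T μ μ ∧ Measurable f ∧ MemLp f (ENNReal.ofReal p) μ ∧
      ∫ ω, f ω ∂μ = 0 ∧
      HolderWIP.FiniteDimTendstoBrownian μ T f ∧
      (∃ C : ℝ, ∀ n : ℕ, 1 ≤ n →
        (∫ ω, |HolderWIP.partialSum T f n ω| ^ p ∂μ) / (n : ℝ) ^ (p / 2) ≤ C) ∧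
      ¬ IsTightMeasureSet {ν : Measure (HolderWIP.HolderSpace (1 / 2 - 1 / p)) |
        ∃ n : ℕ, 1 ≤ n ∧ ν = μ.map
          (HolderWIP.holderPartialSumProcess (HolderWIP.half_sub_inv_le_one hp) T f n)} := by
  have hp1 : 1 ≤ p := by linarith
  exact ⟨(ℤ → ℝ) × HolderWIP.Phases, inferInstance, HolderWIP.productMeasure, inferInstance,
    HolderWIP.productShift, HolderWIP.noisyOscillation p,
    HolderWIP.measurePreserving_productShift, HolderWIP.measurable_noisyOscillation hp1,
    HolderWIP.memLp_noisyOscillation hp1 p.toNNReal, HolderWIP.integral_noisyOscillation hp1,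
    HolderWIP.finiteDimTendstoBrownian_noisyOscillation hp1,
    HolderWIP.exists_integral_partialSum_noisyOscillation_le hp1,
    HolderWIP.not_isTightMeasureSet_noisyOscillation hp⟩
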